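/- Let $a,b>0$ and $\Omega=(0,\pi/a)\times(0,\pi/b)$. Let $H$ be the space of $H^1(\Omega)$ functions $w$ with $w(0,\cdot)=w(\pi/a,\cdot)$ in the sense of traces, and $V\subset H$ the subspace of those that in addition vanish on the walls $y=0$ and $y=\pi/b$. Let $u=(u_1,u_2)$ be a velocity field with $u_1\in H$, $u_2\in V$ (periodicity in $x$ and no flow through the walls), $\nabla\cdot u=0$ and zero mean flow $\int_\Omega u_1=0$, whose vorticity $\omega=\partial_x u_2-\partial_y u_1$ satisfies the mixed boundary conditions in the sense that $\omega\in V$ (no condition on $\partial_x\omega$ at $x=0,\pi/a$ is required), and $\omega\not\equiv0$. Put $$\mathcal K=\tfrac12\int_\Omega|u|^2,\quad \mathcal E=\tfrac12\int_\Omega|\omega|^2,\quad \mathcal P=\tfrac12\int_\Omega|\nabla\omega|^2,\quad \mathcal Q(\omega)=\frac{\mathcal E}{\mathcal K},\quad \Lambda(\omega)=\frac{\mathcal P}{\mathcal E}.$$ Then $\mathcal K>0$, $\mathcal E>0$ and $\Lambda(\omega)\ge\mathcal Q(\omega)$, i.e. $\mathcal E^2\le\mathcal K\,\mathcal P$. Moreover,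 $\Lambda(\omega)=\mathcal Q(\omega)$ if and only if $\omega$ belongs to a single eigenspace of $-\Delta$ with the mixed boundary conditions, i.e. if and only if there is an eigenvalue $\mu$ such that, in the weak sense, $-\Delta\omega=\mu\omega$ in $\Omega$ with $\omega=0$ on the walls $y=0,\pi/b$ and with $\omega$ and $\partial_x\omega$ taking equal values at $x=0$ and $x=\pi/a$. (In particular, this applies at every time $t$ at which a solution of the vorticity equation has a non-zero value $\omega(t)\in V$.) -/

import Mathlib

open MeasureTheory

noncomputable section

namespace KelvinHelmholtz

/-- The rectangle `Ω = (0, π/a) × (0, π/b)`. -/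
def domain (a b : ℝ) : Set (ℝ × ℝ) :=
  Set.Ioo 0 (Real.pi / a) ×ˢ Set.Ioo 0 (Real.pi / b)

/-- Lebesgue measure on `Ω`. -/
def vol (a b : ℝ) : Measure (ℝ × ℝ) := volume.restrict (domain a b)

/-- Test functions: smooth functions on the plane that are `π/a`-periodic in `x` and vanish
near (and beyond) the walls `y = 0` and `y = π/b`.  They are the smooth compactly supported
functions on the cylinder obtained by identifying the sides `x = 0` and `x = π/a` of `Ω`. -/
structure IsTest (a b : ℝ) (φ : ℝ × ℝ → ℝ) : Prop where
  smooth : ContDiff ℝ (⊤ : ℕ∞) φ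
  periodic : ∀ x y, φ (x + Real.pi / a, y) = φ (x, y)
  wall : ∃ δ > 0, ∀ x y, (y ≤ δ ∨ Real.pi / b - δ ≤ y) → φ (x, y) = 0

/-- The classical gradient of a function on the plane. -/
def grad (φ : ℝ × ℝ → ℝ) (p : ℝ × ℝ) : EuclideanSpace ℝ (Fin 2) :=
  !₂[fderiv ℝ φ p (1, 0), fderiv ℝ φ p (0, 1)]

/-- `f ∈ L²(Ω)` has the weak gradient `g ∈ L²(Ω)²`.  As the test functions are periodic in `x`
and need not vanish on the sides `x = 0`, `x = π/a`, this includes that the traces of `f` on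
these two sides agree. -/
structure IsWeakGrad (a b : ℝ) (f : ℝ × ℝ → ℝ) (g : ℝ × ℝ → EuclideanSpace ℝ (Fin 2)) :
    Prop where
  memLp : MemLp f 2 (vol a b)
  memLp_grad : MemLp g 2 (vol a b)
  int_by_parts : ∀ φ, IsTest a b φ → ∀ i : Fin 2,
    ∫ p, f p * grad φ p i ∂(vol a b) = - ∫ p, g p i * φ p ∂(vol a b)

/-- The Sobolev space `H¹` of functions that are periodic in `x`. -/
def MemH1 (a b : ℝ) (f : ℝ × ℝ → ℝ) : Prop := ∃ g, IsWeakGrad a b f g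

open Classical in
/-- The weak gradient (unique almost everywhere in `Ω`) of a function in `H¹`. -/
def weakGrad (a b : ℝ) (f : ℝ × ℝ → ℝ) : ℝ × ℝ → EuclideanSpace ℝ (Fin 2) :=
  if h : MemH1 a b f then h.choose else 0

/-- The space of `H¹` functions that are periodic in `x` and vanish on the walls `y = 0` and
`y = π/b`: the closure of the test functions in the `H¹` norm. -/
def MemH10 (a b : ℝ) (f : ℝ × ℝ → ℝ) : Prop :=
  MemH1 a b f ∧ ∀ ε > 0, ∃ φ, IsTest a b φ ∧
    ∫ p, ((f p - φ p) ^ 2 + ‖weakGrad a b f p - grad φ p‖ ^ 2) ∂(vol a b) < ε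

/-- Incompressible velocity fields of class `H¹` that are periodic in `x`, do not penetrate the
walls `y = 0` and `y = π/b`, and carry no mean flow in the direction of the channel. -/
structure IsVelocity (a b : ℝ) (u : ℝ × ℝ → EuclideanSpace ℝ (Fin 2)) : Prop where
  memH1 : MemH1 a b (fun p => u p 0)
  no_penetration : MemH10 a b (fun p => u p 1)
  div_eq_zero : ∀ᵐ p ∂(vol a b),
    weakGrad a b (fun q => u q 0) p 0 + weakGrad a b (fun q => u q 1) p 1 = 0
  no_mean_flow : ∫ p, u p 0 ∂(vol a b) = 0

/-- The scalar curl `∂₁u₂ - ∂₂u₁`. -/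
def curl (a b : ℝ) (u : ℝ × ℝ → EuclideanSpace ℝ (Fin 2)) (p : ℝ × ℝ) : ℝ :=
  weakGrad a b (fun q => u q 1) p 0 - weakGrad a b (fun q => u q 0) p 1

/-- Kinetic energy. -/
def kineticEnergy (a b : ℝ) (u : ℝ × ℝ → EuclideanSpace ℝ (Fin 2)) : ℝ :=
  1 / 2 * ∫ p, ‖u p‖ ^ 2 ∂(vol a b)

/-- Enstrophy. -/
def enstrophy (a b : ℝ) (ω : ℝ × ℝ → ℝ) : ℝ :=
  1 / 2 * ∫ p, ω p ^ 2 ∂(vol a b)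

/-- Palinstrophy. -/
def palinstrophy (a b : ℝ) (ω : ℝ × ℝ → ℝ) : ℝ :=
  1 / 2 * ∫ p, ‖weakGrad a b ω p‖ ^ 2 ∂(vol a b)

/-- The Rayleigh quotient `Q = E / K` of the vorticity `ω` of the velocity field `u`. -/
def rayleighQuotient (a b : ℝ) (u : ℝ × ℝ → EuclideanSpace ℝ (Fin 2)) (ω : ℝ × ℝ → ℝ) : ℝ :=
  enstrophy a b ω / kineticEnergy a b u

/-- The dissipation rate quotient `Λ = P / E`. -/
def dissipationQuotient (a b : ℝ) (ω : ℝ × ℝ → ℝ) : ℝ :=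
  palinstrophy a b ω / enstrophy a b ω

/-- The (weak) solutions `w`, zero included, of `-Δ w = μ w` with the mixed boundary conditions:
`w = 0` on the walls and periodicity in `x` of `w` and (as the natural condition that comes from
testing with periodic functions) of `∂₁ w`. -/
def eigenspace (a b μ : ℝ) : Set (ℝ × ℝ → ℝ) :=
  {w | MemH10 a b w ∧ ∀ φ, IsTest a b φ →
    ∫ p, inner ℝ (weakGrad a b w p) (grad φ p) ∂(vol a b) = μ * ∫ p, w p * φ p ∂(vol a b)}

/-- `μ` is an eigenvalue of `-Δ` with the mixed boundary conditions. -/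
def IsEigenvalue (a b μ : ℝ) : Prop :=
  ∃ w ∈ eigenspace a b μ, ¬ w =ᵐ[vol a b] 0

end KelvinHelmholtz

end

open KelvinHelmholtz

/-! Write ∇^⊥ω = (∂₂ω, -∂₁ω). Since ω vanishes on the walls and is periodic in x, integration by
parts gives ∫ u·∇^⊥ω = ∫ ω², so the squared L² norm of ∇^⊥ω - t u is the quadratic 2P - 4tE + 2t²K
in t (`IsVelocity.integral_defect`). Its nonnegativity for every t carries the inequalities: K = 0
would leave an affine function of slope -4E < 0, and t = E/K gives E² ≤ KP.

If Λ = Q, the quadratic vanishes at t = Q, so ∇^⊥ω = Q u almost everywhere. Testing with ∇φ turns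
this into the weak equation -Δω = Qω.

The converse must show that -Δω = μω forces V = ∇^⊥ω - μu to vanish
(`IsVelocity.rotated_grad_ae_eq`). This field is divergence-free and tangential to the walls,
because both summands are; it is curl-free by the eigenvalue equation; and its first component has
mean zero, which rules out the constant field (1, 0). No stream function is built: V is paired with
the modes cos(2akx + θ) cos(bmy), and the weak divergence and curl identities kill every
coefficient. The modes are complete because they generate a point-separating algebra
(`ae_eq_zero_of_integral_mode_eq_zero`). As the trigonometric test functions do not vanish near the
walls, a cutoff argument is needed (`integral_eq_zero_of_tendsto_cutoff`). Once V = 0, the quadratic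
vanishes at t = μ; with P = μE this gives E = μK, hence Λ = μ = Q. -/

namespace KelvinHelmholtz

variable {a b : ℝ}

/-! ### Integrability on the rectangle and classical gradients. -/

lemma measurableSet_domain : MeasurableSet (domain a b) :=
  measurableSet_Ioo.prod measurableSet_Ioo

lemma domain_subset_Icc_prod :
    domain a b ⊆ Set.Icc 0 (Real.pi / a) ×ˢ Set.Icc 0 (Real.pi / b) :=
  Set.prod_mono Set.Ioo_subset_Icc_self Set.Ioo_subset_Icc_self

lemma isCompact_Icc_prod :
    IsCompact (Set.Icc 0 (Real.pi / a) ×ˢ Set.Icc 0 (Real.pi / b) : Set (ℝ × ℝ)) :=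
  isCompact_Icc.prod isCompact_Icc

instance isFiniteMeasure_vol : IsFiniteMeasure (vol a b) :=
  ⟨by
    rw [vol, Measure.restrict_apply_univ]
    exact (measure_mono domain_subset_Icc_prod).trans_lt isCompact_Icc_prod.measure_lt_top⟩

lemma memLp_vol_of_continuous {E : Type*} [NormedAddCommGroup E] {f : ℝ × ℝ → E}
    (hf : Continuous f) (q : ENNReal) : MemLp f q (vol a b) := by
  obtain ⟨C, hC⟩ :=
    (isCompact_Icc_prod (a := a) (b := b)).exists_bound_of_continuousOn hf.continuousOn
  exact MemLp.of_bound hf.aestronglyMeasurable C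
    ((ae_restrict_mem measurableSet_domain).mono fun p hp => hC p (domain_subset_Icc_prod hp))

lemma MemLp.apply {g : ℝ × ℝ → EuclideanSpace ℝ (Fin 2)} {μ : Measure (ℝ × ℝ)} {q : ENNReal}
    (hg : MemLp g q μ) (i : Fin 2) : MemLp (fun p => g p i) q μ :=
  (EuclideanSpace.proj (𝕜 := ℝ) i).comp_memLp' hg

lemma inner_fin_two (x y : EuclideanSpace ℝ (Fin 2)) :
    inner ℝ x y = x 0 * y 0 + x 1 * y 1 := by
  rw [PiLp.inner_apply, Fin.sum_univ_two]
  simp [mul_comm]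

lemma norm_sq_fin_two (x : EuclideanSpace ℝ (Fin 2)) : ‖x‖ ^ 2 = x 0 ^ 2 + x 1 ^ 2 := by
  rw [EuclideanSpace.real_norm_sq_eq, Fin.sum_univ_two]

lemma integrable_mul_of_memLp {f g : ℝ × ℝ → ℝ} (hf : MemLp f 2 (vol a b))
    (hg : MemLp g 2 (vol a b)) : Integrable (fun p => f p * g p) (vol a b) :=
  hf.integrable_mul hg

lemma integrable_norm_sq {g : ℝ × ℝ → EuclideanSpace ℝ (Fin 2)} (hg : MemLp g 2 (vol a b)) :
    Integrable (fun p => ‖g p‖ ^ 2) (vol a b) := by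
  simp only [norm_sq_fin_two]
  exact (MemLp.apply hg 0).integrable_sq.add (MemLp.apply hg 1).integrable_sq

lemma integrable_inner_of_memLp {g h : ℝ × ℝ → EuclideanSpace ℝ (Fin 2)}
    (hg : MemLp g 2 (vol a b)) (hh : MemLp h 2 (vol a b)) :
    Integrable (fun p => inner ℝ (g p) (h p)) (vol a b) := by
  simp only [inner_fin_two]
  exact (integrable_mul_of_memLp (MemLp.apply hg 0) (MemLp.apply hh 0)).add
    (integrable_mul_of_memLp (MemLp.apply hg 1) (MemLp.apply hh 1))

@[simp] lemma grad_apply_one (φ : ℝ × ℝ → ℝ) (p : ℝ × ℝ) :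
    grad φ p 1 = fderiv ℝ φ p (0, 1) := rfl

lemma continuous_grad {φ : ℝ × ℝ → ℝ} (hφ : ContDiff ℝ (⊤ : ℕ∞) φ) : Continuous (grad φ) := by
  have h : Continuous (fderiv ℝ φ) := hφ.continuous_fderiv (by simp)
  refine (PiLp.continuous_toLp 2 _).comp (continuous_pi fun i => ?_)
  fin_cases i
  · exact h.clm_apply continuous_const
  · exact h.clm_apply continuous_const

lemma hasDerivAt_fst_of_contDiff {φ : ℝ × ℝ → ℝ} (hφ : ContDiff ℝ (⊤ : ℕ∞) φ) (x y : ℝ) :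
    HasDerivAt (fun t => φ (t, y)) (grad φ (x, y) 0) x := by
  have h := (hφ.differentiable (by simp) (x, y)).hasFDerivAt
  exact h.comp_hasDerivAt x ((hasDerivAt_id x).prodMk (hasDerivAt_const x y))

lemma hasDerivAt_snd_of_contDiff {φ : ℝ × ℝ → ℝ} (hφ : ContDiff ℝ (⊤ : ℕ∞) φ) (x y : ℝ) :
    HasDerivAt (fun t => φ (x, t)) (grad φ (x, y) 1) y := by
  have h := (hφ.differentiable (by simp) (x, y)).hasFDerivAt
  exact h.comp_hasDerivAt y ((hasDerivAt_const y x).prodMk (hasDerivAt_id y))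

lemma IsTest.memLp {φ : ℝ × ℝ → ℝ} (hφ : IsTest a b φ) : MemLp φ 2 (vol a b) :=
  memLp_vol_of_continuous hφ.smooth.continuous 2

lemma IsTest.memLp_grad {φ : ℝ × ℝ → ℝ} (hφ : IsTest a b φ) : MemLp (grad φ) 2 (vol a b) :=
  memLp_vol_of_continuous (continuous_grad hφ.smooth) 2

lemma MemH1.isWeakGrad {f : ℝ × ℝ → ℝ} (hf : MemH1 a b f) :
    IsWeakGrad a b f (weakGrad a b f) := by
  rw [weakGrad, dif_pos hf]
  exact hf.choose_spec

/-! ### Density of test functions and integration by parts. -/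

/-- A continuous linear functional on `H¹` that vanishes on the test functions vanishes on the
closure of the test functions. -/
lemma MemH10.integral_eq_zero {w h : ℝ × ℝ → ℝ} {k : ℝ × ℝ → EuclideanSpace ℝ (Fin 2)}
    (hw : MemH10 a b w) (hh : MemLp h 2 (vol a b)) (hk : MemLp k 2 (vol a b))
    (htest : ∀ φ, IsTest a b φ → ∫ p, (h p * φ p + inner ℝ (k p) (grad φ p)) ∂(vol a b) = 0) :
    ∫ p, (h p * w p + inner ℝ (k p) (weakGrad a b w p)) ∂(vol a b) = 0 := by
  have hwg := hw.1.isWeakGrad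
  set M := ∫ p, (h p ^ 2 + ‖k p‖ ^ 2) ∂(vol a b) with hM
  have hMi : Integrable (fun p => h p ^ 2 + ‖k p‖ ^ 2) (vol a b) :=
    hh.integrable_sq.add (integrable_norm_sq hk)
  have hM0 : 0 ≤ M := integral_nonneg fun p => by positivity
  have key : ∀ t > 0,
      |∫ p, (h p * w p + inner ℝ (k p) (weakGrad a b w p)) ∂(vol a b)| ≤ t * ((M + 1) / 2) := by
    intro t ht
    -- Squared H¹ error t², to be balanced by Young's inequality with weights t/2 and 1/(2t): both
    -- terms are then O(t), and t → 0.
    obtain ⟨φ, hφ, hlt⟩ := hw.2 (t ^ 2) (by positivity)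
    have hD := hwg.memLp.sub hφ.memLp
    have hG := hwg.memLp_grad.sub hφ.memLp_grad
    have hNi : Integrable (fun p => (w p - φ p) ^ 2 + ‖weakGrad a b w p - grad φ p‖ ^ 2)
        (vol a b) := hD.integrable_sq.add (integrable_norm_sq hG)
    have hsub : ∫ p, (h p * w p + inner ℝ (k p) (weakGrad a b w p)) ∂(vol a b) =
        ∫ p, (h p * (w p - φ p) + inner ℝ (k p) (weakGrad a b w p - grad φ p)) ∂(vol a b) := by
      rw [← sub_zero (∫ p, (h p * w p + _) ∂(vol a b)), ← htest φ hφ, ← integral_sub]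
      · refine integral_congr_ae (.of_forall fun p => ?_)
        simp only [inner_sub_right]
        ring
      · exact (integrable_mul_of_memLp hh hwg.memLp).add
          (integrable_inner_of_memLp hk hwg.memLp_grad)
      · exact (integrable_mul_of_memLp hh hφ.memLp).add
          (integrable_inner_of_memLp hk hφ.memLp_grad)
    rw [hsub]
    refine abs_integral_le_integral_abs.trans ?_
    have hpt : ∀ p, |h p * (w p - φ p) + inner ℝ (k p) (weakGrad a b w p - grad φ p)| ≤
        t / 2 * (h p ^ 2 + ‖k p‖ ^ 2) +
          1 / (2 * t) * ((w p - φ p) ^ 2 + ‖weakGrad a b w p - grad φ p‖ ^ 2) := by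
      intro p
      have young : ∀ x y : ℝ, x * y ≤ t / 2 * x ^ 2 + 1 / (2 * t) * y ^ 2 := by
        intro x y
        have : t / 2 * x ^ 2 + 1 / (2 * t) * y ^ 2 - x * y = (t * x - y) ^ 2 / (2 * t) := by
          field_simp
          ring
        have h2 : 0 ≤ (t * x - y) ^ 2 / (2 * t) := by positivity
        linarith
      have h1 := young |h p| |w p - φ p|
      have h2 := young ‖k p‖ ‖weakGrad a b w p - grad φ p‖
      have h3 := abs_real_inner_le_norm (k p) (weakGrad a b w p - grad φ p)
      have h4 := abs_add_le (h p * (w p - φ p)) (inner ℝ (k p) (weakGrad a b w p - grad φ p))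
      rw [abs_mul] at h4
      rw [sq_abs, sq_abs] at h1
      linarith
    calc _ ≤ ∫ p, (t / 2 * (h p ^ 2 + ‖k p‖ ^ 2) +
          1 / (2 * t) * ((w p - φ p) ^ 2 + ‖weakGrad a b w p - grad φ p‖ ^ 2)) ∂(vol a b) :=
          integral_mono_of_nonneg (.of_forall fun p => abs_nonneg _)
            ((hMi.const_mul _).add (hNi.const_mul _)) (.of_forall hpt)
      _ = t / 2 * M + 1 / (2 * t) *
          ∫ p, ((w p - φ p) ^ 2 + ‖weakGrad a b w p - grad φ p‖ ^ 2) ∂(vol a b) := by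
          rw [integral_add (hMi.const_mul _) (hNi.const_mul _), integral_const_mul,
            integral_const_mul]
      _ ≤ t / 2 * M + 1 / (2 * t) * t ^ 2 := by gcongr
      _ = t * ((M + 1) / 2) := by field_simp
  have hlim : Filter.Tendsto (fun t : ℝ => t * ((M + 1) / 2)) (nhdsWithin 0 (Set.Ioi 0))
      (nhds 0) := by
    have : Filter.Tendsto (fun t : ℝ => t * ((M + 1) / 2)) (nhds 0) (nhds (0 * ((M + 1) / 2))) :=
      Filter.tendsto_id.mul_const _
    rw [zero_mul] at this
    exact this.mono_left nhdsWithin_le_nhds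
  have := ge_of_tendsto hlim (Filter.eventually_of_mem self_mem_nhdsWithin fun t ht => key t ht)
  exact abs_nonpos_iff.1 this

lemma integral_vol {f : ℝ × ℝ → ℝ} (hf : Integrable f (vol a b)) :
    ∫ p, f p ∂(vol a b) =
      ∫ x in Set.Ioo 0 (Real.pi / a), ∫ y in Set.Ioo 0 (Real.pi / b), f (x, y) :=
  setIntegral_prod f hf

/-- The integral of a partial derivative of a test function vanishes. -/
lemma IsTest.integral_grad (ha : 0 < a) (hb : 0 < b) {φ : ℝ × ℝ → ℝ} (hφ : IsTest a b φ)
    (i : Fin 2) : ∫ p, grad φ p i ∂(vol a b) = 0 := by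
  have hc : ∀ i, Continuous fun p => grad φ p i := fun i =>
    (EuclideanSpace.proj (𝕜 := ℝ) i).continuous.comp (continuous_grad hφ.smooth)
  have hi : ∀ i, Integrable (fun p => grad φ p i) (vol a b) := fun i =>
    memLp_one_iff_integrable.1 (memLp_vol_of_continuous (hc i) 1)
  have hA : 0 ≤ Real.pi / a := by positivity
  have hB : 0 ≤ Real.pi / b := by positivity
  have hxper : ∀ y, φ (Real.pi / a, y) = φ (0, y) := fun y => by
    simpa using hφ.periodic 0 y
  fin_cases i
  · change ∫ p, grad φ p 0 ∂(vol a b) = 0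
    rw [integral_vol (hi 0), integral_integral_swap]
    · refine integral_eq_zero_of_ae (.of_forall fun y => ?_)
      change ∫ x in Set.Ioo 0 (Real.pi / a), grad φ (x, y) 0 = 0
      rw [← integral_Ioc_eq_integral_Ioo, ← intervalIntegral.integral_of_le hA,
        intervalIntegral.integral_eq_sub_of_hasDerivAt
          (fun x _ => hasDerivAt_fst_of_contDiff hφ.smooth x y), hxper, sub_self]
      exact ((hc 0).comp (by fun_prop : Continuous fun x : ℝ => (x, y))).intervalIntegrable _ _
    · have := hi 0
      rwa [vol, domain, Measure.volume_eq_prod, ← Measure.prod_restrict] at this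
  · change ∫ p, grad φ p 1 ∂(vol a b) = 0
    rw [integral_vol (hi 1)]
    obtain ⟨δ, hδ, hwall⟩ := hφ.wall
    refine integral_eq_zero_of_ae (.of_forall fun x => ?_)
    change ∫ y in Set.Ioo 0 (Real.pi / b), grad φ (x, y) 1 = 0
    rw [← integral_Ioc_eq_integral_Ioo, ← intervalIntegral.integral_of_le hB,
      intervalIntegral.integral_eq_sub_of_hasDerivAt
        (fun y _ => hasDerivAt_snd_of_contDiff hφ.smooth x y),
      hwall x _ (Or.inl hδ.le), hwall x _ (Or.inr (by linarith)), sub_self]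
    exact ((hc 1).comp (by fun_prop : Continuous fun y : ℝ => (x, y))).intervalIntegrable _ _

lemma IsTest.mul {φ η : ℝ × ℝ → ℝ} (hφ : IsTest a b φ) (hη : ContDiff ℝ (⊤ : ℕ∞) η)
    (hper : ∀ x y, η (x + Real.pi / a, y) = η (x, y)) : IsTest a b (fun p => η p * φ p) where
  smooth := hη.mul hφ.smooth
  periodic x y := by simp only [hper, hφ.periodic]
  wall := by
    obtain ⟨δ, hδ, h⟩ := hφ.wall
    exact ⟨δ, hδ, fun x y hy => by simp only [h x y hy, mul_zero]⟩

lemma grad_mul {φ η : ℝ × ℝ → ℝ} (hφ : ContDiff ℝ (⊤ : ℕ∞) φ) (hη : ContDiff ℝ (⊤ : ℕ∞) η)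
    (p : ℝ × ℝ) (i : Fin 2) :
    grad (fun q => η q * φ q) p i = η p * grad φ p i + grad η p i * φ p := by
  have h := fderiv_fun_mul (hη.differentiable (by simp) p) (hφ.differentiable (by simp) p)
  fin_cases i <;> simp [grad, h, mul_comm (φ p)]

/-- Integration by parts in the space of functions vanishing on the walls, against smooth
periodic functions that need not vanish there. -/
lemma MemH10.integral_mul_grad (ha : 0 < a) (hb : 0 < b) {w η : ℝ × ℝ → ℝ}
    (hw : MemH10 a b w) (hη : ContDiff ℝ (⊤ : ℕ∞) η)
    (hper : ∀ x y, η (x + Real.pi / a, y) = η (x, y)) (i : Fin 2) :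
    ∫ p, (grad η p i * w p + η p * weakGrad a b w p i) ∂(vol a b) = 0 := by
  have hinner : ∀ (p : ℝ × ℝ) (x : EuclideanSpace ℝ (Fin 2)),
      inner ℝ (EuclideanSpace.single i (η p)) x = η p * x i := fun p x => by
    simp [EuclideanSpace.inner_single_left]
  have hc : Continuous fun p => (EuclideanSpace.single i (η p) : EuclideanSpace ℝ (Fin 2)) := by
    have : (fun p => (EuclideanSpace.single i (η p) : EuclideanSpace ℝ (Fin 2))) =
        fun p => η p • EuclideanSpace.single i (1 : ℝ) := by
      funext p
      ext j
      by_cases hj : j = i <;> simp [hj]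
    rw [this]
    exact hη.continuous.smul continuous_const
  -- With the pair (∂ᵢη, η eᵢ), the functional on a test function φ is ∫ ∂ᵢ(ηφ) = 0, because ηφ is
  -- again a test function.
  have hmain := hw.integral_eq_zero (h := fun p => grad η p i)
    (k := fun p => EuclideanSpace.single i (η p))
    (MemLp.apply (memLp_vol_of_continuous (continuous_grad hη) 2) i)
    (memLp_vol_of_continuous hc 2) ?_
  · simpa only [hinner] using hmain
  · intro φ hφ
    rw [← (hφ.mul hη hper).integral_grad ha hb i]
    refine integral_congr_ae (.of_forall fun p => ?_)
    simp only [hinner]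
    rw [grad_mul hφ.smooth hη, add_comm]

/-! ### The quadratic defect and the inequality between the quotients. -/

lemma memLp_vec {f g : ℝ × ℝ → ℝ} {q : ENNReal} {μ : Measure (ℝ × ℝ)}
    (hf : MemLp f q μ) (hg : MemLp g q μ) :
    MemLp (fun p => (!₂[f p, g p] : EuclideanSpace ℝ (Fin 2))) q μ := by
  let e : Fin 2 → ℝ →L[ℝ] EuclideanSpace ℝ (Fin 2) := fun i =>
    ContinuousLinearMap.toSpanSingleton ℝ (EuclideanSpace.single i (1 : ℝ))
  have h := ((e 0).comp_memLp' hf).add ((e 1).comp_memLp' hg)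
  refine (memLp_congr_ae (.of_forall fun p => ?_)).1 h
  ext i
  fin_cases i <;> simp [e]

lemma IsVelocity.memLp_zero {u : ℝ × ℝ → EuclideanSpace ℝ (Fin 2)} (hu : IsVelocity a b u) :
    MemLp (fun p => u p 0) 2 (vol a b) := hu.memH1.isWeakGrad.memLp

lemma IsVelocity.memLp_one {u : ℝ × ℝ → EuclideanSpace ℝ (Fin 2)} (hu : IsVelocity a b u) :
    MemLp (fun p => u p 1) 2 (vol a b) := hu.no_penetration.1.isWeakGrad.memLp

lemma IsVelocity.integral_vorticity_mul_test {u : ℝ × ℝ → EuclideanSpace ℝ (Fin 2)}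
    {ω φ : ℝ × ℝ → ℝ} (hu : IsVelocity a b u) (hcurl : ω =ᵐ[vol a b] curl a b u)
    (hφ : IsTest a b φ) :
    ∫ p, ω p * φ p ∂(vol a b) =
      ∫ p, (u p 0 * grad φ p 1 - u p 1 * grad φ p 0) ∂(vol a b) := by
  have h0 := hu.memH1.isWeakGrad
  have h1 := hu.no_penetration.1.isWeakGrad
  calc ∫ p, ω p * φ p ∂(vol a b)
      = ∫ p, (weakGrad a b (fun q => u q 1) p 0 * φ p -
          weakGrad a b (fun q => u q 0) p 1 * φ p) ∂(vol a b) := by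
        refine integral_congr_ae ?_
        filter_upwards [hcurl] with p hp
        rw [hp, curl, sub_mul]
    _ = _ := by
        rw [integral_sub
            (integrable_mul_of_memLp (MemLp.apply h1.memLp_grad 0) hφ.memLp)
            (integrable_mul_of_memLp (MemLp.apply h0.memLp_grad 1) hφ.memLp),
          integral_sub
            (integrable_mul_of_memLp h0.memLp (MemLp.apply hφ.memLp_grad 1))
            (integrable_mul_of_memLp h1.memLp (MemLp.apply hφ.memLp_grad 0)),
          h0.int_by_parts φ hφ 1, h1.int_by_parts φ hφ 0]
        ring

/-- The weak definition of the curl, with ω itself as test function. Membership of ω in the closure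
of the test functions permits this, since both sides are H¹-continuous in the test function. -/
lemma IsVelocity.integral_sq_vorticity {u : ℝ × ℝ → EuclideanSpace ℝ (Fin 2)}
    {ω : ℝ × ℝ → ℝ} (hu : IsVelocity a b u) (hcurl : ω =ᵐ[vol a b] curl a b u)
    (hω : MemH10 a b ω) :
    ∫ p, ω p ^ 2 ∂(vol a b) =
      ∫ p, (u p 0 * weakGrad a b ω p 1 - u p 1 * weakGrad a b ω p 0) ∂(vol a b) := by
  have hg := hω.1.isWeakGrad
  have hint : ∀ g : ℝ × ℝ → EuclideanSpace ℝ (Fin 2), MemLp g 2 (vol a b) →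
      Integrable (fun p => u p 0 * g p 1 - u p 1 * g p 0) (vol a b) := fun g hg =>
    (integrable_mul_of_memLp hu.memLp_zero (MemLp.apply hg 1)).sub
      (integrable_mul_of_memLp hu.memLp_one (MemLp.apply hg 0))
  have h := hω.integral_eq_zero (h := ω) (k := fun p => !₂[u p 1, -u p 0]) hg.memLp
    (memLp_vec hu.memLp_one hu.memLp_zero.neg) ?_
  · rw [← sub_eq_zero, ← integral_sub hg.memLp.integrable_sq (hint _ hg.memLp_grad), ← h]
    refine integral_congr_ae (.of_forall fun p => ?_)
    simp only [inner_fin_two, Matrix.cons_val_zero, Matrix.cons_val_one]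
    ring
  · intro φ hφ
    have := hu.integral_vorticity_mul_test hcurl hφ
    rw [← sub_eq_zero, ← integral_sub (integrable_mul_of_memLp hg.memLp hφ.memLp)
      (hint _ hφ.memLp_grad)] at this
    rw [← this]
    refine integral_congr_ae (.of_forall fun p => ?_)
    simp only [inner_fin_two, Matrix.cons_val_zero, Matrix.cons_val_one]
    ring

/-- The squared `L²` distance between the rotated vorticity gradient and `t • u`. -/
lemma IsVelocity.integral_defect {u : ℝ × ℝ → EuclideanSpace ℝ (Fin 2)}
    {ω : ℝ × ℝ → ℝ} (hu : IsVelocity a b u) (hcurl : ω =ᵐ[vol a b] curl a b u)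
    (hω : MemH10 a b ω) (t : ℝ) :
    ∫ p, ((weakGrad a b ω p 1 - t * u p 0) ^ 2 + (weakGrad a b ω p 0 + t * u p 1) ^ 2)
        ∂(vol a b) =
      2 * palinstrophy a b ω - 4 * t * enstrophy a b ω + 2 * t ^ 2 * kineticEnergy a b u := by
  have hg := hω.1.isWeakGrad.memLp_grad
  have hP : Integrable (fun p => ‖weakGrad a b ω p‖ ^ 2) (vol a b) := integrable_norm_sq hg
  have hK : Integrable (fun p => ‖u p‖ ^ 2) (vol a b) := by
    simp only [norm_sq_fin_two]
    exact hu.memLp_zero.integrable_sq.add hu.memLp_one.integrable_sq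
  have hE : Integrable (fun p => u p 0 * weakGrad a b ω p 1 - u p 1 * weakGrad a b ω p 0)
      (vol a b) :=
    (integrable_mul_of_memLp hu.memLp_zero (MemLp.apply hg 1)).sub
      (integrable_mul_of_memLp hu.memLp_one (MemLp.apply hg 0))
  calc _ = ∫ p, (‖weakGrad a b ω p‖ ^ 2 -
          2 * t * (u p 0 * weakGrad a b ω p 1 - u p 1 * weakGrad a b ω p 0) +
          t ^ 2 * ‖u p‖ ^ 2) ∂(vol a b) := by
        refine integral_congr_ae (.of_forall fun p => ?_)
        simp only [norm_sq_fin_two]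
        ring
    _ = _ := by
        have hPE : Integrable (fun p => ‖weakGrad a b ω p‖ ^ 2 -
            2 * t * (u p 0 * weakGrad a b ω p 1 - u p 1 * weakGrad a b ω p 0)) (vol a b) :=
          hP.sub (hE.const_mul _)
        rw [integral_add hPE (hK.const_mul _), integral_sub hP (hE.const_mul _), integral_const_mul, integral_const_mul,
          ← hu.integral_sq_vorticity hcurl hω, palinstrophy, enstrophy, kineticEnergy]
        ring

lemma enstrophy_pos {ω : ℝ × ℝ → ℝ} (hω : MemLp ω 2 (vol a b))
    (hne : ¬ ω =ᵐ[vol a b] 0) : 0 < enstrophy a b ω := by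
  have h0 : 0 ≤ ∫ p, ω p ^ 2 ∂(vol a b) := integral_nonneg fun p => sq_nonneg _
  refine mul_pos (by norm_num) (lt_of_le_of_ne h0 fun h => hne ?_)
  have := (integral_eq_zero_iff_of_nonneg (fun p => sq_nonneg (ω p)) hω.integrable_sq).1 h.symm
  filter_upwards [this] with p hp
  exact pow_eq_zero_iff two_ne_zero |>.1 hp

lemma IsVelocity.kineticEnergy_pos {u : ℝ × ℝ → EuclideanSpace ℝ (Fin 2)}
    {ω : ℝ × ℝ → ℝ} (hu : IsVelocity a b u) (hcurl : ω =ᵐ[vol a b] curl a b u)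
    (hω : MemH10 a b ω) (hne : ¬ ω =ᵐ[vol a b] 0) : 0 < kineticEnergy a b u := by
  have hE := enstrophy_pos hω.1.isWeakGrad.memLp hne
  have h0 : 0 ≤ kineticEnergy a b u :=
    mul_nonneg (by norm_num) (integral_nonneg fun p => sq_nonneg _)
  refine lt_of_le_of_ne h0 fun h => ?_
  -- If K = 0, this t makes the defect 2P - 4tE equal to -2.
  have hd := hu.integral_defect hcurl hω ((palinstrophy a b ω + 1) / (2 * enstrophy a b ω))
  have hn : 0 ≤ 2 * palinstrophy a b ω -
      4 * ((palinstrophy a b ω + 1) / (2 * enstrophy a b ω)) * enstrophy a b ω := by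
    have := hd ▸ integral_nonneg fun p => by positivity
    rwa [← h, mul_zero, add_zero] at this
  have h2 : 4 * ((palinstrophy a b ω + 1) / (2 * enstrophy a b ω)) * enstrophy a b ω =
      2 * (palinstrophy a b ω + 1) := by
    field_simp
    ring
  linarith

lemma IsVelocity.sq_enstrophy_le {u : ℝ × ℝ → EuclideanSpace ℝ (Fin 2)}
    {ω : ℝ × ℝ → ℝ} (hu : IsVelocity a b u) (hcurl : ω =ᵐ[vol a b] curl a b u)
    (hω : MemH10 a b ω) (hne : ¬ ω =ᵐ[vol a b] 0) :
    enstrophy a b ω ^ 2 ≤ kineticEnergy a b u * palinstrophy a b ω := by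
  have hK := hu.kineticEnergy_pos hcurl hω hne
  -- The minimiser of the quadratic in t.
  have hd := hu.integral_defect hcurl hω (enstrophy a b ω / kineticEnergy a b u)
  have hn := hd ▸ integral_nonneg fun p => by positivity
  have h2 : 2 * palinstrophy a b ω -
      4 * (enstrophy a b ω / kineticEnergy a b u) * enstrophy a b ω +
      2 * (enstrophy a b ω / kineticEnergy a b u) ^ 2 * kineticEnergy a b u =
      2 * (kineticEnergy a b u * palinstrophy a b ω - enstrophy a b ω ^ 2) /
        kineticEnergy a b u := by
    field_simp
    ring
  rw [h2] at hn
  have := mul_nonneg hn hK.le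
  rw [div_mul_cancel₀ _ hK.ne'] at this
  linarith

/-- If the two quotients agree, the rotated vorticity gradient is a multiple of the velocity, and
so the vorticity is an eigenfunction. -/
lemma IsVelocity.mem_eigenspace_of_quotients_eq {u : ℝ × ℝ → EuclideanSpace ℝ (Fin 2)}
    {ω : ℝ × ℝ → ℝ} (hu : IsVelocity a b u) (hcurl : ω =ᵐ[vol a b] curl a b u)
    (hω : MemH10 a b ω) (hne : ¬ ω =ᵐ[vol a b] 0)
    (heq : dissipationQuotient a b ω = rayleighQuotient a b u ω) :
    ω ∈ eigenspace a b (rayleighQuotient a b u ω) := by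
  have hK := hu.kineticEnergy_pos hcurl hω hne
  have hE := enstrophy_pos hω.1.isWeakGrad.memLp hne
  have hg := hω.1.isWeakGrad.memLp_grad
  set t := rayleighQuotient a b u ω with ht
  have hEK : enstrophy a b ω = t * kineticEnergy a b u := by
    rw [ht, rayleighQuotient]
    field_simp
  have hPE : palinstrophy a b ω = t * enstrophy a b ω := by
    rw [← heq, dissipationQuotient]
    field_simp
  have hd := hu.integral_defect hcurl hω t
  have hd0 : 2 * palinstrophy a b ω - 4 * t * enstrophy a b ω +
      2 * t ^ 2 * kineticEnergy a b u = 0 := by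
    rw [hPE, hEK]
    ring
  have hint : Integrable (fun p => (weakGrad a b ω p 1 - t * u p 0) ^ 2 +
      (weakGrad a b ω p 0 + t * u p 1) ^ 2) (vol a b) :=
    ((MemLp.apply hg 1).sub (hu.memLp_zero.const_mul t)).integrable_sq.add
      ((MemLp.apply hg 0).add (hu.memLp_one.const_mul t)).integrable_sq
  rw [hd0, integral_eq_zero_iff_of_nonneg (fun p => by positivity) hint] at hd
  refine ⟨hω, fun φ hφ => ?_⟩
  rw [hu.integral_vorticity_mul_test hcurl hφ, ← integral_const_mul]
  refine integral_congr_ae ?_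
  filter_upwards [hd] with p hp
  have hp' : (weakGrad a b ω p 1 - t * u p 0) ^ 2 + (weakGrad a b ω p 0 + t * u p 1) ^ 2 = 0 := hp
  have h1 : weakGrad a b ω p 1 - t * u p 0 = 0 := by nlinarith
  have h0 : weakGrad a b ω p 0 + t * u p 1 = 0 := by nlinarith
  rw [inner_fin_two, sub_eq_zero.1 h1, eq_neg_of_add_eq_zero_left h0]
  ring

/-! ### Completeness of the Fourier modes. -/

/-- The Fourier mode `cos (2akx + θ) cos (bmy)`. -/
noncomputable def mode (a b : ℝ) (k : ℤ) (θ : ℝ) (m : ℤ) (p : ℝ × ℝ) : ℝ :=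
  Real.cos (2 * a * k * p.1 + θ) * Real.cos (b * m * p.2)

lemma continuous_mode (k : ℤ) (θ : ℝ) (m : ℤ) : Continuous (mode a b k θ m) := by
  unfold mode
  fun_prop

lemma abs_mode_le (k : ℤ) (θ : ℝ) (m : ℤ) (p : ℝ × ℝ) : |mode a b k θ m p| ≤ 1 := by
  rw [mode, abs_mul]
  exact mul_le_one₀ (Real.abs_cos_le_one _) (abs_nonneg _) (Real.abs_cos_le_one _)

/-- Product-to-sum in both variables. The free phase θ covers sines too and keeps the span of the
modes closed under products. -/
lemma mode_mul_mode (k l : ℤ) (θ η : ℝ) (m n : ℤ) (p : ℝ × ℝ) :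
    mode a b k θ m p * mode a b l η n p =
      1 / 4 * (mode a b (k + l) (θ + η) (m + n) p + mode a b (k + l) (θ + η) (m - n) p +
        mode a b (k - l) (θ - η) (m + n) p + mode a b (k - l) (θ - η) (m - n) p) := by
  have h : ∀ x y : ℝ, Real.cos x * Real.cos y = 1 / 2 * (Real.cos (x + y) + Real.cos (x - y)) := by
    intro x y
    rw [Real.cos_add, Real.cos_sub]
    ring
  have h1 := h (2 * a * k * p.1 + θ) (2 * a * l * p.1 + η)
  have h2 := h (b * m * p.2) (b * n * p.2)
  have e1 : 2 * a * k * p.1 + θ + (2 * a * l * p.1 + η) =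
      2 * a * (k + l : ℤ) * p.1 + (θ + η) := by push_cast; ring
  have e2 : 2 * a * k * p.1 + θ - (2 * a * l * p.1 + η) =
      2 * a * (k - l : ℤ) * p.1 + (θ - η) := by push_cast; ring
  have e3 : b * m * p.2 + b * n * p.2 = b * (m + n : ℤ) * p.2 := by push_cast; ring
  have e4 : b * m * p.2 - b * n * p.2 = b * (m - n : ℤ) * p.2 := by push_cast; ring
  rw [e1, e2] at h1
  rw [e3, e4] at h2
  simp only [mode]
  rw [mul_mul_mul_comm, h1, h2]
  ring

/-- Cosine is injective on (0, π), which recovers by; the angle 2ax in (0, 2π) needs both cosine and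
sine, the latter from the phase -π/2. -/
lemma exists_mode_ne (ha : 0 < a) (hb : 0 < b) {p q : ℝ × ℝ} (hp : p ∈ domain a b)
    (hq : q ∈ domain a b) (hpq : p ≠ q) : ∃ k θ m, mode a b k θ m p ≠ mode a b k θ m q := by
  by_contra! hcon
  apply hpq
  obtain ⟨⟨hp1, hp2⟩, hp3, hp4⟩ := hp
  obtain ⟨⟨hq1, hq2⟩, hq3, hq4⟩ := hq
  rw [lt_div_iff₀ ha] at hp2 hq2
  rw [lt_div_iff₀ hb] at hp4 hq4
  have hy : b * p.2 = b * q.2 := by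
    refine Real.injOn_cos ⟨by positivity, by linarith⟩ ⟨by positivity, by linarith⟩ ?_
    simpa [mode] using hcon 0 0 1
  have hx : 2 * a * p.1 = 2 * a * q.1 := by
    have hc : Real.cos (2 * a * p.1) = Real.cos (2 * a * q.1) := by
      simpa [mode] using hcon 1 0 0
    have hs : Real.sin (2 * a * p.1) = Real.sin (2 * a * q.1) := by
      have := hcon 1 (-(Real.pi / 2)) 0
      simpa [mode, ← sub_eq_add_neg, Real.cos_sub_pi_div_two] using this
    have hang : Real.cos (2 * a * p.1 - 2 * a * q.1) = 1 := by
      rw [Real.cos_sub, hc, hs, ← sq, ← sq, Real.cos_sq_add_sin_sq]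
    have := (Real.cos_eq_one_iff_of_lt_of_lt (by nlinarith) (by nlinarith)).1 hang
    linarith
  refine Prod.ext ?_ ?_
  · exact mul_left_cancel₀ (by positivity) hx
  · exact mul_left_cancel₀ hb.ne' hy

/-- The mode as a bounded continuous function on the rectangle. -/
noncomputable def modeBCF (a b : ℝ) (k : ℤ) (θ : ℝ) (m : ℤ) : BoundedContinuousFunction (domain a b) ℝ :=
  BoundedContinuousFunction.ofNormedAddCommGroup (fun p => mode a b k θ m p)
    ((continuous_mode k θ m).comp continuous_subtype_val) 1 fun p => abs_mode_le k θ m p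

@[simp] lemma modeBCF_apply (k : ℤ) (θ : ℝ) (m : ℤ) (p : domain a b) :
    modeBCF a b k θ m p = mode a b k θ m p := rfl

/-- An integrable function orthogonal to all modes is also orthogonal to every element of the
algebra that the modes generate. -/
lemma integral_mul_adjoin_mode_eq_zero {ν : Measure (domain a b)} {f : domain a b → ℝ}
    (hf : Integrable f ν) (h : ∀ k θ m, ∫ p, f p * mode a b k θ m p ∂ν = 0)
    {g : BoundedContinuousFunction (domain a b) ℝ}
    (hg : g ∈ Algebra.adjoin ℝ {g | ∃ k θ m, g = modeBCF a b k θ m}) :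
    ∫ p, f p * g p ∂ν = 0 := by
  have hint : ∀ (g : BoundedContinuousFunction (domain a b) ℝ), Integrable (fun p => f p * g p) ν :=
    fun g => hf.mul_bdd (c := ‖g‖) g.continuous.aestronglyMeasurable
      (.of_forall fun p => g.norm_coe_le_norm p)
  -- Strengthened induction: multiplying by g preserves orthogonality of f g' to all modes.
  -- Quantifying over g' makes the product case a composition.
  have hstep : ∀ g' : BoundedContinuousFunction (domain a b) ℝ,
      (∀ k θ m, ∫ p, f p * g' p * mode a b k θ m p ∂ν = 0) →
      ∀ k θ m, ∫ p, f p * (g * g') p * mode a b k θ m p ∂ν = 0 := by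
    induction hg using Algebra.adjoin_induction with
    | mem x hx =>
      obtain ⟨l, η, n, rfl⟩ := hx
      intro g' hg' k θ m
      have hi : ∀ k θ m, Integrable (fun p : domain a b => f p * g' p * mode a b k θ m p) ν :=
        fun k θ m => (hint (g' * modeBCF a b k θ m)).congr
          (.of_forall fun p => by simp [mul_assoc])
      have : ∀ p : domain a b, f p * (modeBCF a b l η n * g') p * mode a b k θ m p =
          1 / 4 * (f p * g' p * mode a b (l + k) (η + θ) (n + m) p +
            f p * g' p * mode a b (l + k) (η + θ) (n - m) p +
            f p * g' p * mode a b (l - k) (η - θ) (n + m) p +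
            f p * g' p * mode a b (l - k) (η - θ) (n - m) p) := by
        intro p
        have := mode_mul_mode (a := a) (b := b) l k η θ n m p
        simp only [BoundedContinuousFunction.coe_mul, Pi.mul_apply, modeBCF_apply]
        linear_combination f p * g' p * this
      simp only [this]
      have hadd : ∀ {v w : domain a b → ℝ}, Integrable v ν → Integrable w ν →
          Integrable (fun p => v p + w p) ν := fun hv hw => hv.add hw
      rw [integral_const_mul,
        integral_add (hadd (hadd (hi _ _ _) (hi _ _ _)) (hi _ _ _)) (hi _ _ _),
        integral_add (hadd (hi _ _ _) (hi _ _ _)) (hi _ _ _), integral_add (hi _ _ _) (hi _ _ _)]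
      simp [hg']
    | algebraMap r =>
      intro g' hg' k θ m
      have : ∀ p : domain a b, f p * (algebraMap ℝ _ r * g') p * mode a b k θ m p =
          r * (f p * g' p * mode a b k θ m p) := fun p => by
        simp only [BoundedContinuousFunction.coe_mul, Pi.mul_apply,
          BoundedContinuousFunction.algebraMap_apply, smul_eq_mul, mul_one]
        ring
      simp only [this, integral_const_mul, hg', mul_zero]
    | add x y _ _ hx hy =>
      intro g' hg' k θ m
      have hi : ∀ x : BoundedContinuousFunction (domain a b) ℝ,
          Integrable (fun p : domain a b => f p * (x * g') p * mode a b k θ m p) ν :=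
        fun x => (hint (x * g' * modeBCF a b k θ m)).congr
          (.of_forall fun p => by simp [mul_assoc])
      have := integral_add (hi x) (hi y)
      rw [hx g' hg', hy g' hg', add_zero] at this
      rw [← this]
      refine integral_congr_ae (.of_forall fun p => ?_)
      simp only [BoundedContinuousFunction.coe_mul, Pi.mul_apply,
        BoundedContinuousFunction.coe_add, Pi.add_apply]
      ring
    | mul x y _ _ hx hy =>
      intro g' hg' k θ m
      rw [mul_assoc]
      exact hx _ (hy g' hg') k θ m
  have := hstep 1 (fun k θ m => by simpa using h k θ m) 0 0 0
  simpa [mode] using this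

/-- Completeness of the Fourier modes `cos (2akx + θ) cos (bmy)`. -/
lemma ae_eq_zero_of_integral_mode_eq_zero (ha : 0 < a) (hb : 0 < b) {f : ℝ × ℝ → ℝ}
    (hf : Integrable f (vol a b)) (h : ∀ k θ m, ∫ p, f p * mode a b k θ m p ∂(vol a b) = 0) :
    f =ᵐ[vol a b] 0 := by
  have hopen : IsOpen (domain a b) := isOpen_Ioo.prod isOpen_Ioo
  have := hopen.polishSpace
  set ν : Measure (domain a b) := (volume : Measure (ℝ × ℝ)).comap Subtype.val with hν
  set F : domain a b → ℝ := fun p => f p with hF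
  have hmap : ν.map Subtype.val = vol a b := map_comap_subtype_coe measurableSet_domain _
  have hFi : Integrable F ν := by
    rw [← hmap] at hf
    exact ((MeasurableEmbedding.subtype_coe measurableSet_domain).integrable_map_iff).1 hf
  have hmode : ∀ k θ m, ∫ p, F p * mode a b k θ m p ∂ν = 0 := fun k θ m => by
    rw [← h k θ m]
    exact integral_subtype_comap measurableSet_domain fun p => f p * mode a b k θ m p
  have hpos : IsFiniteMeasure (ν.withDensity fun p => ENNReal.ofReal (F p)) :=
    isFiniteMeasure_withDensity_ofReal hFi.2
  have hneg : IsFiniteMeasure (ν.withDensity fun p => ENNReal.ofReal (-F p)) :=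
    isFiniteMeasure_withDensity_ofReal hFi.neg.2
  let A : StarSubalgebra ℝ (BoundedContinuousFunction (domain a b) ℝ) :=
    { Algebra.adjoin ℝ {g | ∃ k θ m, g = modeBCF a b k θ m} with
      star_mem' := fun {g} hg => by
        rwa [show star g = g from by ext p; simp] }
  -- `ENNReal.ofReal` truncates at 0, so these are the finite measures with densities F⁺ and F⁻.
  -- They agree on a point-separating algebra of bounded continuous functions on a Polish space,
  -- hence coincide.
  have heq : (ν.withDensity fun p => ENNReal.ofReal (F p)) =
      ν.withDensity fun p => ENNReal.ofReal (-F p) := by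
    refine ext_of_forall_mem_subalgebra_integral_eq_of_polish (𝕜 := ℝ) (A := A) ?_ ?_
    · intro p q hpq
      obtain ⟨k, θ, m, hne⟩ := exists_mode_ne ha hb p.2 q.2 (fun h => hpq (Subtype.ext h))
      refine ⟨_, ⟨_, ⟨modeBCF a b k θ m, ?_, rfl⟩, rfl⟩, hne⟩
      exact Algebra.subset_adjoin ⟨k, θ, m, rfl⟩
    · intro g hg
      have hg0 := integral_mul_adjoin_mode_eq_zero hFi hmode (g := g) hg
      have hwd : ∀ G : domain a b → ℝ, Integrable G ν →
          ∫ p, g p ∂(ν.withDensity fun p => ENNReal.ofReal (G p)) =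
            ∫ p, max (G p) 0 * g p ∂ν := by
        intro G hG
        rw [integral_withDensity_eq_integral_toReal_smul₀ hG.1.aemeasurable.ennreal_ofReal
          (.of_forall fun p => ENNReal.ofReal_lt_top)]
        simp only [ENNReal.toReal_ofReal', smul_eq_mul]
      rw [hwd F hFi, hwd (fun p => -F p) hFi.neg, ← sub_eq_zero, ← integral_sub]
      · refine (integral_congr_ae ?_).trans hg0
        refine .of_forall fun p => ?_
        change max (F p) 0 * g p - max (-F p) 0 * g p = F p * g p
        rw [← sub_mul]
        congr 1
        rcases le_total (F p) 0 with h0 | h0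
        · rw [max_eq_right h0, max_eq_left (by linarith)]; ring
        · rw [max_eq_left h0, max_eq_right (by linarith)]; ring
      · exact hFi.pos_part.mul_bdd (c := ‖g‖) g.continuous.aestronglyMeasurable
          (.of_forall fun p => g.norm_coe_le_norm p)
      · exact hFi.neg_part.mul_bdd (c := ‖g‖) g.continuous.aestronglyMeasurable
          (.of_forall fun p => g.norm_coe_le_norm p)
  rw [withDensity_eq_iff hFi.1.aemeasurable.ennreal_ofReal
    (g := fun p => ENNReal.ofReal (-F p)) hFi.neg.1.aemeasurable.ennreal_ofReal
    hFi.lintegral_lt_top.ne] at heq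
  rw [vol, Filter.EventuallyEq, ae_restrict_iff_subtype measurableSet_domain]
  filter_upwards [heq] with p hp
  change F p = 0
  rcases le_total (F p) 0 with h0 | h0
  · rw [ENNReal.ofReal_of_nonpos h0] at hp
    have := ENNReal.ofReal_eq_zero.1 hp.symm
    linarith
  · rw [ENNReal.ofReal_of_nonpos (p := -F p) (by linarith)] at hp
    have := ENNReal.ofReal_eq_zero.1 hp
    linarith

/-! ### Cutoffs near the walls. -/

open Filter Topology

/-- A smooth cutoff that vanishes within distance `1 / (n + 1)` of the walls. -/
noncomputable def cutoff (b : ℝ) (n : ℕ) (p : ℝ × ℝ) : ℝ :=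
  Real.smoothTransition ((n + 1) * p.2 - 1) *
    Real.smoothTransition ((n + 1) * (Real.pi / b - p.2) - 1)

lemma contDiff_cutoff (n : ℕ) : ContDiff ℝ (⊤ : ℕ∞) (cutoff b n) :=
  (Real.smoothTransition.contDiff.comp (by fun_prop)).mul
    (Real.smoothTransition.contDiff.comp (by fun_prop))

lemma isTest_cutoff (n : ℕ) : IsTest a b (cutoff b n) where
  smooth := contDiff_cutoff n
  periodic _ _ := rfl
  wall := by
    have hn : (0 : ℝ) < n + 1 := by positivity
    refine ⟨1 / (n + 1), by positivity, fun x y hy => ?_⟩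
    rcases hy with hy | hy
    · rw [le_div_iff₀ hn] at hy
      rw [cutoff, Real.smoothTransition.zero_of_nonpos, zero_mul]
      simp only
      linarith
    · have hy' : Real.pi / b - y ≤ 1 / (n + 1) := by linarith
      rw [le_div_iff₀ hn] at hy'
      rw [cutoff, mul_comm, Real.smoothTransition.zero_of_nonpos, zero_mul]
      simp only
      linarith

lemma abs_cutoff_le (n : ℕ) (p : ℝ × ℝ) : |cutoff b n p| ≤ 1 := by
  rw [cutoff, abs_of_nonneg
    (mul_nonneg (Real.smoothTransition.nonneg _) (Real.smoothTransition.nonneg _))]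
  exact mul_le_one₀ (Real.smoothTransition.le_one _) (Real.smoothTransition.nonneg _)
    (Real.smoothTransition.le_one _)

/-- Equality on a neighbourhood, and not only at the point, makes the gradient vanish eventually as
well. -/
lemma eventually_cutoff_eq_one {p : ℝ × ℝ} (hp : p ∈ domain a b) :
    ∀ᶠ n : ℕ in atTop, ∀ᶠ q in 𝓝 p, cutoff b n q = 1 := by
  obtain ⟨-, h0, h1⟩ := hp
  have hlim : Tendsto (fun n : ℕ => (n : ℝ) + 1) atTop atTop :=
    tendsto_atTop_add_const_right _ _ tendsto_natCast_atTop_atTop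
  filter_upwards [(hlim.atTop_mul_const h0).eventually_gt_atTop 2,
    (hlim.atTop_mul_const (sub_pos.2 h1)).eventually_gt_atTop 2] with n hn0 hn1
  have c0 : Continuous fun q : ℝ × ℝ => ((n : ℝ) + 1) * q.2 := by fun_prop
  have c1 : Continuous fun q : ℝ × ℝ => ((n : ℝ) + 1) * (Real.pi / b - q.2) := by fun_prop
  filter_upwards [c0.continuousAt.eventually_const_lt hn0,
    c1.continuousAt.eventually_const_lt hn1] with q hq0 hq1
  rw [cutoff, Real.smoothTransition.one_of_one_le (by linarith),
    Real.smoothTransition.one_of_one_le (by linarith), one_mul]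

lemma eventually_grad_cutoff_eq_zero {p : ℝ × ℝ} (hp : p ∈ domain a b) :
    ∀ᶠ n : ℕ in atTop, grad (cutoff b n) p 1 = 0 := by
  filter_upwards [eventually_cutoff_eq_one hp] with n hn
  have : cutoff b n =ᶠ[𝓝 p] fun _ => 1 := hn
  rw [grad_apply_one, this.fderiv_eq]
  simp

lemma grad_cutoff_zero (n : ℕ) (p : ℝ × ℝ) : grad (cutoff b n) p 0 = 0 := by
  have h := hasDerivAt_fst_of_contDiff (contDiff_cutoff (b := b) n) p.1 p.2
  exact h.unique (hasDerivAt_const p.1 (cutoff b n p))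

lemma grad_cutoff_one (n : ℕ) (p : ℝ × ℝ) :
    grad (cutoff b n) p 1 =
      (n + 1) * deriv Real.smoothTransition ((n + 1) * p.2 - 1) *
        Real.smoothTransition ((n + 1) * (Real.pi / b - p.2) - 1) -
      Real.smoothTransition ((n + 1) * p.2 - 1) *
        ((n + 1) * deriv Real.smoothTransition ((n + 1) * (Real.pi / b - p.2) - 1)) := by
  have hT : ∀ x, HasDerivAt Real.smoothTransition (deriv Real.smoothTransition x) x := fun x =>
    ((Real.smoothTransition.contDiff (n := 1)).differentiable (by simp) x).hasDerivAt
  have h := hasDerivAt_snd_of_contDiff (contDiff_cutoff (b := b) n) p.1 p.2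
  have e0 : HasDerivAt (fun y : ℝ => ((n : ℝ) + 1) * y - 1) (n + 1) p.2 := by
    simpa using ((hasDerivAt_id p.2).const_mul ((n : ℝ) + 1)).sub_const 1
  have e1 : HasDerivAt (fun y : ℝ => ((n : ℝ) + 1) * (Real.pi / b - y) - 1) (-(n + 1)) p.2 := by
    simpa using (((hasDerivAt_id p.2).const_sub (Real.pi / b)).const_mul ((n : ℝ) + 1)).sub_const 1
  have h' := ((hT _).comp p.2 e0).mul ((hT _).comp p.2 e1)
  rw [h.unique h']
  simp only [Function.comp_apply]
  ring

/-- The derivative vanishes unless 1 ≤ t ≤ 2. With t = (n + 1)·(distance to a wall), this is the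
n-independent bound on distance times cutoff slope. -/
lemma exists_bound_mul_deriv_smoothTransition :
    ∃ C, ∀ t, |t * deriv Real.smoothTransition (t - 1)| ≤ C := by
  have hc : Continuous fun t : ℝ => t * deriv Real.smoothTransition (t - 1) :=
    continuous_id.mul (((Real.smoothTransition.contDiff (n := 1)).continuous_deriv le_rfl).comp
      (by fun_prop))
  obtain ⟨C, hC⟩ := (isCompact_Icc (a := (1 : ℝ)) (b := 2)).exists_bound_of_continuousOn
    hc.continuousOn
  refine ⟨max C 0, fun t => ?_⟩
  by_cases ht : t ∈ Set.Icc (1 : ℝ) 2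
  · exact (hC t ht).trans (le_max_left _ _)
  · have hz : deriv Real.smoothTransition (t - 1) = 0 := by
      rcases lt_or_ge t 1 with h | h
      · have : Real.smoothTransition =ᶠ[𝓝 (t - 1)] fun _ => 0 :=
          eventually_of_mem (Iio_mem_nhds (by linarith : t - 1 < 0)) fun x hx =>
            Real.smoothTransition.zero_of_nonpos (le_of_lt hx)
        rw [this.deriv_eq, deriv_const]
      · have h2 : 2 < t := lt_of_not_ge fun h2 => ht ⟨h, h2⟩
        have : Real.smoothTransition =ᶠ[𝓝 (t - 1)] fun _ => 1 :=
          eventually_of_mem (Ioi_mem_nhds (by linarith : 1 < t - 1)) fun x hx =>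
            Real.smoothTransition.one_of_one_le (le_of_lt hx)
        rw [this.deriv_eq, deriv_const]
    rw [hz, mul_zero, abs_zero]
    exact le_max_right _ _

/-- The gradient of the cutoff is controlled by the inverse distance to the walls. -/
lemma exists_bound_grad_cutoff : ∃ C, ∀ (n : ℕ), ∀ p ∈ domain a b,
    min p.2 (Real.pi / b - p.2) * |grad (cutoff b n) p 1| ≤ C := by
  obtain ⟨C, hC⟩ := exists_bound_mul_deriv_smoothTransition
  refine ⟨C + C, fun n p hp => ?_⟩
  obtain ⟨-, h0, h1⟩ := hp
  have h1' : 0 < Real.pi / b - p.2 := sub_pos.2 h1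
  set D := deriv Real.smoothTransition
  have hT : ∀ x, |Real.smoothTransition x| ≤ 1 := fun x => by
    rw [abs_of_nonneg (Real.smoothTransition.nonneg x)]
    exact Real.smoothTransition.le_one x
  have hA : p.2 * |(n + 1) * D ((n + 1) * p.2 - 1)| ≤ C := by
    rw [← abs_of_pos h0, ← abs_mul, abs_of_pos h0, ← mul_assoc, mul_comm p.2]
    exact hC _
  have hB : (Real.pi / b - p.2) * |(n + 1) * D ((n + 1) * (Real.pi / b - p.2) - 1)| ≤ C := by
    rw [← abs_of_pos h1', ← abs_mul, abs_of_pos h1', ← mul_assoc, mul_comm (Real.pi / b - p.2)]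
    exact hC _
  have hmin0 : 0 ≤ min p.2 (Real.pi / b - p.2) := le_min h0.le h1'.le
  rw [grad_cutoff_one]
  calc _ ≤ min p.2 (Real.pi / b - p.2) * (|(n + 1) * D ((n + 1) * p.2 - 1)| +
        |(n + 1) * D ((n + 1) * (Real.pi / b - p.2) - 1)|) := by
        refine mul_le_mul_of_nonneg_left ((abs_sub _ _).trans (add_le_add ?_ ?_)) hmin0
        · rw [abs_mul]
          exact mul_le_of_le_one_right (abs_nonneg _) (hT _)
        · rw [abs_mul]
          exact mul_le_of_le_one_left (abs_nonneg _) (hT _)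
    _ ≤ _ := by
        rw [mul_add]
        exact add_le_add
          ((mul_le_mul_of_nonneg_right (min_le_left _ _) (abs_nonneg _)).trans hA)
          ((mul_le_mul_of_nonneg_right (min_le_right _ _) (abs_nonneg _)).trans hB)

/-- A smooth function vanishing on the walls is bounded by the distance to the walls. -/
lemma exists_bound_of_wall {η : ℝ × ℝ → ℝ} (hη : ContDiff ℝ (⊤ : ℕ∞) η)
    (h0 : ∀ x, η (x, 0) = 0) (h1 : ∀ x, η (x, Real.pi / b) = 0) :
    ∃ C, 0 ≤ C ∧ ∀ p ∈ domain a b, |η p| ≤ C * min p.2 (Real.pi / b - p.2) := by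
  obtain ⟨C, hC⟩ := (isCompact_Icc_prod (a := a) (b := b)).exists_bound_of_continuousOn
    ((EuclideanSpace.proj (𝕜 := ℝ) (1 : Fin 2)).continuous.comp (continuous_grad hη)).continuousOn
  refine ⟨max C 0, le_max_right _ _, fun p hp => ?_⟩
  have hp' := domain_subset_Icc_prod hp
  obtain ⟨-, hp0, hp1⟩ := hp
  have hlip : ∀ y ∈ Set.Icc 0 (Real.pi / b), ∀ z ∈ Set.Icc 0 (Real.pi / b),
      ‖η (p.1, z) - η (p.1, y)‖ ≤ max C 0 * ‖z - y‖ := fun y hy z hz =>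
    (convex_Icc 0 (Real.pi / b)).norm_image_sub_le_of_norm_hasDerivWithin_le
      (f := fun y => η (p.1, y)) (f' := fun y => grad η (p.1, y) 1)
      (fun y _ => (hasDerivAt_snd_of_contDiff hη p.1 y).hasDerivWithinAt)
      (fun y hy => (hC (p.1, y) ⟨hp'.1, hy⟩).trans (le_max_left _ _)) hy hz
  have hL : (0 : ℝ) ≤ Real.pi / b := (hp0.trans hp1).le
  have e0 := hlip 0 ⟨le_rfl, hL⟩ p.2 hp'.2
  have e1 := hlip (Real.pi / b) ⟨hL, le_rfl⟩ p.2 hp'.2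
  rw [h0, sub_zero, sub_zero, Real.norm_eq_abs, Real.norm_eq_abs, abs_of_pos hp0] at e0
  rw [h1, sub_zero, norm_sub_rev, Real.norm_eq_abs, Real.norm_eq_abs,
    abs_of_pos (sub_pos.2 hp1)] at e1
  rcases min_choice p.2 (Real.pi / b - p.2) with h | h <;> rw [h]
  · exact e0
  · exact e1

lemma tendsto_integral_mul_cutoff {f : ℝ × ℝ → ℝ} (hf : Integrable f (vol a b)) :
    Tendsto (fun n => ∫ p, f p * cutoff b n p ∂(vol a b)) atTop (𝓝 (∫ p, f p ∂(vol a b))) := by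
  refine tendsto_integral_of_dominated_convergence (fun p => |f p|)
    (fun n => hf.1.mul (contDiff_cutoff n).continuous.aestronglyMeasurable) hf.abs
    (fun n => .of_forall fun p => ?_) ?_
  · rw [Real.norm_eq_abs, abs_mul]
    exact mul_le_of_le_one_right (abs_nonneg _) (abs_cutoff_le n p)
  · filter_upwards [ae_restrict_mem measurableSet_domain] with p hp
    refine tendsto_const_nhds.congr' ?_
    filter_upwards [eventually_cutoff_eq_one hp] with n hn
    rw [hn.self_of_nhds, mul_one]

/-- Near the walls η is of the order of the distance and the cutoff slope of the order of its
inverse, so the integrand is dominated by a multiple of |f| while it tends to 0 pointwise. -/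
lemma tendsto_integral_mul_grad_cutoff {f η : ℝ × ℝ → ℝ} (hf : Integrable f (vol a b))
    (hη : ContDiff ℝ (⊤ : ℕ∞) η) (h0 : ∀ x, η (x, 0) = 0) (h1 : ∀ x, η (x, Real.pi / b) = 0) :
    Tendsto (fun n => ∫ p, f p * η p * grad (cutoff b n) p 1 ∂(vol a b)) atTop (𝓝 0) := by
  obtain ⟨C, hC⟩ := exists_bound_grad_cutoff (a := a) (b := b)
  obtain ⟨M, hM0, hM⟩ := exists_bound_of_wall (a := a) hη h0 h1
  rw [← integral_zero (ℝ × ℝ) ℝ (μ := vol a b)]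
  refine tendsto_integral_of_dominated_convergence (fun p => |f p| * (M * C))
    (fun n => ?_) (hf.abs.mul_const _) (fun n => ?_) ?_
  · refine (hf.1.mul hη.continuous.aestronglyMeasurable).mul
      (Continuous.aestronglyMeasurable ?_)
    exact (EuclideanSpace.proj (𝕜 := ℝ) (1 : Fin 2)).continuous.comp
      (continuous_grad (contDiff_cutoff n))
  · filter_upwards [ae_restrict_mem measurableSet_domain] with p hp
    rw [Real.norm_eq_abs, abs_mul, abs_mul, mul_assoc]
    refine mul_le_mul_of_nonneg_left ?_ (abs_nonneg _)
    calc |η p| * |grad (cutoff b n) p 1|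
        ≤ M * min p.2 (Real.pi / b - p.2) * |grad (cutoff b n) p 1| :=
          mul_le_mul_of_nonneg_right (hM p hp) (abs_nonneg _)
      _ ≤ M * C := by
          rw [mul_assoc]
          exact mul_le_mul_of_nonneg_left (hC n p hp) hM0
  · filter_upwards [ae_restrict_mem measurableSet_domain] with p hp
    refine tendsto_const_nhds.congr' ?_
    filter_upwards [eventually_grad_cutoff_eq_zero hp] with n hn
    rw [hn, mul_zero]

/-! ### Test functions that need not vanish near the walls. -/

/-- A first-order functional that vanishes on test functions vanishes on every smooth periodic
function for which the boundary layer term disappears. -/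
lemma integral_eq_zero_of_tendsto_cutoff {h η : ℝ × ℝ → ℝ}
    {k : ℝ × ℝ → EuclideanSpace ℝ (Fin 2)}
    (hh : MemLp h 2 (vol a b)) (hk : MemLp k 2 (vol a b))
    (htest : ∀ φ, IsTest a b φ → ∫ p, (h p * φ p + inner ℝ (k p) (grad φ p)) ∂(vol a b) = 0)
    (hη : ContDiff ℝ (⊤ : ℕ∞) η) (hper : ∀ x y, η (x + Real.pi / a, y) = η (x, y))
    (hlayer : Tendsto (fun n => ∫ p, k p 1 * η p * grad (cutoff b n) p 1 ∂(vol a b))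
      atTop (𝓝 0)) :
    ∫ p, (h p * η p + inner ℝ (k p) (grad η p)) ∂(vol a b) = 0 := by
  have hη2 : MemLp η 2 (vol a b) := memLp_vol_of_continuous hη.continuous 2
  have hg2 : MemLp (grad η) 2 (vol a b) := memLp_vol_of_continuous (continuous_grad hη) 2
  have hF : Integrable (fun p => h p * η p + inner ℝ (k p) (grad η p)) (vol a b) :=
    (integrable_mul_of_memLp hh hη2).add (integrable_inner_of_memLp hk hg2)
  have hlim := (tendsto_integral_mul_cutoff hF).add hlayer
  rw [add_zero] at hlim
  refine tendsto_nhds_unique hlim (tendsto_const_nhds.congr fun n => ?_)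
  have ht := (isTest_cutoff (a := a) (b := b) n)
  rw [← htest _ (ht.mul hη hper), ← integral_add]
  · refine integral_congr_ae (.of_forall fun p => ?_)
    simp only [inner_fin_two, grad_mul ht.smooth hη, grad_cutoff_zero]
    ring
  · exact hF.mul_bdd (c := 1) (contDiff_cutoff n).continuous.aestronglyMeasurable
      (.of_forall fun p => abs_cutoff_le n p)
  · have : MemLp (fun p => η p * grad (cutoff b n) p 1) 2 (vol a b) :=
      memLp_vol_of_continuous (hη.continuous.mul
        ((EuclideanSpace.proj (𝕜 := ℝ) (1 : Fin 2)).continuous.comp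
          (continuous_grad ht.smooth))) 2
    simpa only [mul_assoc] using integrable_mul_of_memLp (MemLp.apply hk 1) this

/-- Integration by parts in `x` against smooth periodic functions that need not vanish on the
walls. -/
lemma MemH1.integral_mul_grad_zero {f η : ℝ × ℝ → ℝ} (hf : MemH1 a b f)
    (hη : ContDiff ℝ (⊤ : ℕ∞) η) (hper : ∀ x y, η (x + Real.pi / a, y) = η (x, y)) :
    ∫ p, (weakGrad a b f p 0 * η p + f p * grad η p 0) ∂(vol a b) = 0 := by
  have hg := hf.isWeakGrad
  -- The second component of k is 0, so there is no boundary layer term and η is free on the walls.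
  have h := integral_eq_zero_of_tendsto_cutoff (h := fun p => weakGrad a b f p 0)
    (k := fun p => !₂[f p, 0]) (MemLp.apply hg.memLp_grad 0)
    (memLp_vec hg.memLp MemLp.zero') ?_ hη hper (by simp)
  · rw [← h]
    refine integral_congr_ae (.of_forall fun p => ?_)
    simp only [inner_fin_two, Matrix.cons_val_zero, Matrix.cons_val_one]
    ring
  · intro φ hφ
    have := hg.int_by_parts φ hφ 0
    rw [eq_neg_iff_add_eq_zero, ← integral_add
      (integrable_mul_of_memLp hg.memLp (MemLp.apply hφ.memLp_grad 0))
      (integrable_mul_of_memLp (MemLp.apply hg.memLp_grad 0) hφ.memLp)] at this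
    refine Eq.trans (integral_congr_ae (.of_forall fun p => ?_)) this
    simp only [inner_fin_two, Matrix.cons_val_zero, Matrix.cons_val_one]
    ring

section Separated

variable {s s' F F' : ℝ → ℝ}

lemma grad_separated_zero (hs : ∀ x, HasDerivAt s (s' x) x) (hsc : ContDiff ℝ (⊤ : ℕ∞) s)
    (hFc : ContDiff ℝ (⊤ : ℕ∞) F) (p : ℝ × ℝ) :
    grad (fun q => s q.1 * F q.2) p 0 = s' p.1 * F p.2 :=
  (hasDerivAt_fst_of_contDiff (φ := fun q => s q.1 * F q.2)
    ((hsc.comp contDiff_fst).mul (hFc.comp contDiff_snd)) p.1 p.2).unique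
    ((hs p.1).mul_const (F p.2))

lemma grad_separated_one (hF : ∀ y, HasDerivAt F (F' y) y) (hsc : ContDiff ℝ (⊤ : ℕ∞) s)
    (hFc : ContDiff ℝ (⊤ : ℕ∞) F) (p : ℝ × ℝ) :
    grad (fun q => s q.1 * F q.2) p 1 = s p.1 * F' p.2 :=
  (hasDerivAt_snd_of_contDiff (φ := fun q => s q.1 * F q.2)
    ((hsc.comp contDiff_fst).mul (hFc.comp contDiff_snd)) p.1 p.2).unique
    ((hF p.2).const_mul (s p.1))

lemma memLp_separated (hs : Continuous s) (hF : Continuous F) :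
    MemLp (fun p : ℝ × ℝ => s p.1 * F p.2) 2 (vol a b) :=
  memLp_vol_of_continuous ((hs.comp continuous_fst).mul (hF.comp continuous_snd)) 2

/-- Velocity fields are orthogonal to gradients of smooth periodic functions. -/
lemma IsVelocity.integral_separated (ha : 0 < a) (hb : 0 < b)
    {u : ℝ × ℝ → EuclideanSpace ℝ (Fin 2)} (hu : IsVelocity a b u)
    (hs : ∀ x, HasDerivAt s (s' x) x) (hF : ∀ y, HasDerivAt F (F' y) y)
    (hsc : ContDiff ℝ (⊤ : ℕ∞) s) (hFc : ContDiff ℝ (⊤ : ℕ∞) F)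
    (hper : ∀ x, s (x + Real.pi / a) = s x) :
    ∫ p, (u p 0 * (s' p.1 * F p.2) + u p 1 * (s p.1 * F' p.2)) ∂(vol a b) = 0 := by
  have hη : ContDiff ℝ (⊤ : ℕ∞) fun p : ℝ × ℝ => s p.1 * F p.2 :=
    (hsc.comp contDiff_fst).mul (hFc.comp contDiff_snd)
  have hη2 : MemLp (fun p : ℝ × ℝ => s p.1 * F p.2) 2 (vol a b) :=
    memLp_vol_of_continuous hη.continuous 2
  have hg2 := memLp_vol_of_continuous (a := a) (b := b) (continuous_grad hη) 2
  have h0 := hu.memH1.integral_mul_grad_zero hη fun x y => by simp only [hper]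
  have h1 := hu.no_penetration.integral_mul_grad ha hb hη (fun x y => by simp only [hper]) 1
  have hsum := integral_add
    ((integrable_mul_of_memLp (MemLp.apply hu.memH1.isWeakGrad.memLp_grad 0) hη2).add
      (integrable_mul_of_memLp hu.memLp_zero (MemLp.apply hg2 0)))
    ((integrable_mul_of_memLp (MemLp.apply hg2 1) hu.memLp_one).add
      (integrable_mul_of_memLp hη2 (MemLp.apply hu.no_penetration.1.isWeakGrad.memLp_grad 1)))
  refine Eq.trans (integral_congr_ae ?_) (hsum.trans ((congrArg₂ (· + ·) h0 h1).trans (add_zero 0)))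
  filter_upwards [hu.div_eq_zero] with p hp
  simp only [Pi.add_apply]
  rw [grad_separated_zero hs hsc hFc, grad_separated_one hF hsc hFc]
  linear_combination -(s p.1 * F p.2) * hp

/-- Rotated gradients of functions vanishing on the walls are orthogonal to gradients of smooth
periodic functions. -/
lemma MemH10.integral_separated (ha : 0 < a) (hb : 0 < b) {ω : ℝ × ℝ → ℝ}
    (hω : MemH10 a b ω) (hs : ∀ x, HasDerivAt s (s' x) x) (hF : ∀ y, HasDerivAt F (F' y) y)
    (hsc : ContDiff ℝ (⊤ : ℕ∞) s) (hsc' : ContDiff ℝ (⊤ : ℕ∞) s')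
    (hFc : ContDiff ℝ (⊤ : ℕ∞) F) (hFc' : ContDiff ℝ (⊤ : ℕ∞) F')
    (hper : ∀ x, s (x + Real.pi / a) = s x) (hper' : ∀ x, s' (x + Real.pi / a) = s' x) :
    ∫ p, (weakGrad a b ω p 1 * (s' p.1 * F p.2) - weakGrad a b ω p 0 * (s p.1 * F' p.2))
      ∂(vol a b) = 0 := by
  have hg := hω.1.isWeakGrad
  have hη1 : ContDiff ℝ (⊤ : ℕ∞) fun p : ℝ × ℝ => s' p.1 * F p.2 :=
    (hsc'.comp contDiff_fst).mul (hFc.comp contDiff_snd)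
  have hη0 : ContDiff ℝ (⊤ : ℕ∞) fun p : ℝ × ℝ => s p.1 * F' p.2 :=
    (hsc.comp contDiff_fst).mul (hFc'.comp contDiff_snd)
  -- Both integrations by parts produce the same mixed term s'F'ω, which cancels in the difference.
  have h1 := hω.integral_mul_grad ha hb hη1 (fun x y => by simp only [hper']) 1
  have h0 := hω.integral_mul_grad ha hb hη0 (fun x y => by simp only [hper]) 0
  have hint : ∀ {η : ℝ × ℝ → ℝ}, ContDiff ℝ (⊤ : ℕ∞) η → ∀ i,
      Integrable (fun p => grad η p i * ω p + η p * weakGrad a b ω p i) (vol a b) := by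
    intro η hη i
    have hη2 : MemLp η 2 (vol a b) := memLp_vol_of_continuous hη.continuous 2
    have hg2 := memLp_vol_of_continuous (a := a) (b := b) (continuous_grad hη) 2
    exact (integrable_mul_of_memLp (MemLp.apply hg2 i) hg.memLp).add
      (integrable_mul_of_memLp hη2 (MemLp.apply hg.memLp_grad i))
  have hdiff := integral_sub (hint hη1 1) (hint hη0 0)
  rw [h1, h0, sub_zero] at hdiff
  refine Eq.trans (integral_congr_ae (.of_forall fun p => ?_)) hdiff
  simp only
  rw [grad_separated_zero hs hsc hFc', grad_separated_one hF hsc' hFc]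
  ring

end Separated

/-! ### The equality case: the defect field of an eigenfunction vanishes. -/

/-- An eigenfunction that is the vorticity of a velocity field yields a curl-free rotated
gradient defect, tested against smooth functions vanishing on the walls. -/
lemma IsVelocity.integral_curl_defect {u : ℝ × ℝ → EuclideanSpace ℝ (Fin 2)}
    {ω η : ℝ × ℝ → ℝ} {μ : ℝ} (hu : IsVelocity a b u) (hcurl : ω =ᵐ[vol a b] curl a b u)
    (hω : ω ∈ eigenspace a b μ) (hη : ContDiff ℝ (⊤ : ℕ∞) η)
    (hper : ∀ x y, η (x + Real.pi / a, y) = η (x, y))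
    (h0 : ∀ x, η (x, 0) = 0) (h1 : ∀ x, η (x, Real.pi / b) = 0) :
    ∫ p, ((weakGrad a b ω p 1 - μ * u p 0) * grad η p 1 +
      (weakGrad a b ω p 0 + μ * u p 1) * grad η p 0) ∂(vol a b) = 0 := by
  have hg := hω.1.1.isWeakGrad.memLp_grad
  have hV1 : MemLp (fun p => weakGrad a b ω p 1 - μ * u p 0) 2 (vol a b) :=
    (MemLp.apply hg 1).sub (hu.memLp_zero.const_mul μ)
  have hV0 : MemLp (fun p => weakGrad a b ω p 0 + μ * u p 1) 2 (vol a b) :=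
    (MemLp.apply hg 0).add (hu.memLp_one.const_mul μ)
  have h := integral_eq_zero_of_tendsto_cutoff (h := fun _ => 0)
    (k := fun p => !₂[weakGrad a b ω p 0 + μ * u p 1, weakGrad a b ω p 1 - μ * u p 0])
    MemLp.zero' (memLp_vec hV0 hV1) ?_ hη hper ?_
  · refine Eq.trans (integral_congr_ae (.of_forall fun p => ?_)) h
    simp only [inner_fin_two, Matrix.cons_val_zero, Matrix.cons_val_one]
    ring
  · intro φ hφ
    have hv := hu.integral_vorticity_mul_test hcurl hφ
    have he := hω.2 φ hφ
    rw [hv, ← sub_eq_zero, ← integral_const_mul, ← integral_sub] at he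
    · refine Eq.trans (integral_congr_ae (.of_forall fun p => ?_)) he
      simp only [inner_fin_two, Matrix.cons_val_zero, Matrix.cons_val_one]
      ring
    · exact integrable_inner_of_memLp hg hφ.memLp_grad
    · exact ((integrable_mul_of_memLp hu.memLp_zero (MemLp.apply hφ.memLp_grad 1)).sub
        (integrable_mul_of_memLp hu.memLp_one (MemLp.apply hφ.memLp_grad 0))).const_mul μ
  · exact tendsto_integral_mul_grad_cutoff (hV1.integrable one_le_two) hη h0 h1

/-- An eigenfunction that is the vorticity of a velocity field has a rotated gradient proportional
to that velocity field. -/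
lemma IsVelocity.rotated_grad_ae_eq (ha : 0 < a) (hb : 0 < b)
    {u : ℝ × ℝ → EuclideanSpace ℝ (Fin 2)} {ω : ℝ × ℝ → ℝ} {μ : ℝ} (hu : IsVelocity a b u)
    (hcurl : ω =ᵐ[vol a b] curl a b u) (hω : ω ∈ eigenspace a b μ) :
    (fun p => weakGrad a b ω p 1 - μ * u p 0) =ᵐ[vol a b] 0 ∧
      (fun p => weakGrad a b ω p 0 + μ * u p 1) =ᵐ[vol a b] 0 := by
  have hg := hω.1.1.isWeakGrad.memLp_grad
  set V1 : ℝ × ℝ → ℝ := fun p => weakGrad a b ω p 1 - μ * u p 0 with hV1def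
  set V0 : ℝ × ℝ → ℝ := fun p => weakGrad a b ω p 0 + μ * u p 1 with hV0def
  have hV1 : MemLp V1 2 (vol a b) := (MemLp.apply hg 1).sub (hu.memLp_zero.const_mul μ)
  have hV0 : MemLp V0 2 (vol a b) := (MemLp.apply hg 0).add (hu.memLp_one.const_mul μ)
  -- The defect field is (V1, -V0). This is its weak divergence identity; F is unrestricted on the
  -- walls, which encodes tangency.
  have hdiv : ∀ {s s' F F' : ℝ → ℝ}, (∀ x, HasDerivAt s (s' x) x) →
      (∀ y, HasDerivAt F (F' y) y) → ContDiff ℝ (⊤ : ℕ∞) s → ContDiff ℝ (⊤ : ℕ∞) s' →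
      ContDiff ℝ (⊤ : ℕ∞) F → ContDiff ℝ (⊤ : ℕ∞) F' → (∀ x, s (x + Real.pi / a) = s x) →
      (∀ x, s' (x + Real.pi / a) = s' x) →
      ∫ p, (V1 p * (s' p.1 * F p.2) - V0 p * (s p.1 * F' p.2)) ∂(vol a b) = 0 := by
    intro s s' F F' hs hF hsc hsc' hFc hFc' hper hper'
    have h1 := hω.1.integral_separated ha hb hs hF hsc hsc' hFc hFc' hper hper'
    have h2 := hu.integral_separated ha hb hs hF hsc hFc hper
    have hm1 := memLp_separated (a := a) (b := b) hsc'.continuous hFc.continuous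
    have hm0 := memLp_separated (a := a) (b := b) hsc.continuous hFc'.continuous
    have h3 : ∫ p, (weakGrad a b ω p 1 * (s' p.1 * F p.2) -
        weakGrad a b ω p 0 * (s p.1 * F' p.2)) ∂(vol a b) -
        μ * ∫ p, (u p 0 * (s' p.1 * F p.2) + u p 1 * (s p.1 * F' p.2)) ∂(vol a b) = 0 := by
      rw [h1, h2, mul_zero, sub_zero]
    rw [← integral_const_mul, ← integral_sub] at h3
    · refine Eq.trans (integral_congr_ae (.of_forall fun p => ?_)) h3
      simp only [hV1def, hV0def]
      ring
    · exact (integrable_mul_of_memLp (MemLp.apply hg 1) hm1).sub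
        (integrable_mul_of_memLp (MemLp.apply hg 0) hm0)
    · exact ((integrable_mul_of_memLp hu.memLp_zero hm1).add
        (integrable_mul_of_memLp hu.memLp_one hm0)).const_mul μ
  have hangle : ∀ (k : ℤ) (θ x : ℝ),
      2 * a * k * (x + Real.pi / a) + θ = 2 * a * k * x + θ + k * (2 * Real.pi) := by
    intro k θ x
    field_simp
    ring
  have hcosper : ∀ (k : ℤ) (θ x : ℝ),
      Real.cos (2 * a * k * (x + Real.pi / a) + θ) = Real.cos (2 * a * k * x + θ) := by
    intro k θ x
    rw [hangle, Real.cos_add_int_mul_two_pi]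
  have hsinper : ∀ (k : ℤ) (θ x : ℝ),
      Real.sin (2 * a * k * (x + Real.pi / a) + θ) = Real.sin (2 * a * k * x + θ) := by
    intro k θ x
    rw [hangle, Real.sin_add_int_mul_two_pi]
  have hdcos : ∀ c θ x : ℝ, HasDerivAt (fun x => Real.cos (c * x + θ))
      (-c * Real.sin (c * x + θ)) x := by
    intro c θ x
    have := (((hasDerivAt_id x).const_mul c).add_const θ).cos
    simp only [id, mul_one] at this
    convert this using 1
    ring
  have hdsin : ∀ c θ x : ℝ, HasDerivAt (fun x => Real.sin (c * x + θ))
      (c * Real.cos (c * x + θ)) x := by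
    intro c θ x
    have := (((hasDerivAt_id x).const_mul c).add_const θ).sin
    simp only [id, mul_one] at this
    convert this using 1
    ring
  have hccos : ∀ c θ : ℝ, ContDiff ℝ (⊤ : ℕ∞) fun x => Real.cos (c * x + θ) := fun c θ => by
    fun_prop
  have hcsin : ∀ c θ : ℝ, ContDiff ℝ (⊤ : ℕ∞) fun x => Real.sin (c * x + θ) := fun c θ => by
    fun_prop
  have hsinL : ∀ m : ℤ, Real.sin (b * m * (Real.pi / b) + 0) = 0 := by
    intro m
    have : b * m * (Real.pi / b) + 0 = m * Real.pi := by
      field_simp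
      ring
    rw [this, Real.sin_int_mul_pi]
  have hmode1 : ∀ k θ m, ∫ p, V1 p * mode a b k θ m p ∂(vol a b) = 0 := by
    intro k θ m
    -- The constant mode is the only one with c² + d² = 0 below; there the absence of mean flow is
    -- essential.
    by_cases hkm : k = 0 ∧ m = 0
    · obtain ⟨rfl, rfl⟩ := hkm
      have hgi : ∫ p, weakGrad a b ω p 1 ∂(vol a b) = 0 := by
        have := hω.1.integral_mul_grad ha hb (η := fun _ => 1) contDiff_const (fun _ _ => rfl) 1
        simpa using this
      have hV : ∫ p, V1 p ∂(vol a b) = 0 := by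
        rw [hV1def, integral_sub ((MemLp.apply hg 1).integrable one_le_two)
          ((hu.memLp_zero.const_mul μ).integrable one_le_two), integral_const_mul,
          hu.no_mean_flow, hgi, mul_zero, sub_zero]
      have : ∀ p, V1 p * mode a b 0 θ 0 p = V1 p * Real.cos θ := fun p => by simp [mode]
      simp only [this]
      rw [integral_mul_const, hV, zero_mul]
    · set c : ℝ := 2 * a * k with hc
      set d : ℝ := b * m with hd
      have hcd : c ^ 2 + d ^ 2 ≠ 0 := by
        intro h0
        have hc0 : c = 0 := by nlinarith [sq_nonneg c, sq_nonneg d]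
        have hd0 : d = 0 := by nlinarith [sq_nonneg c, sq_nonneg d]
        refine hkm ⟨?_, ?_⟩
        · rw [hc] at hc0
          simpa [ha.ne'] using hc0
        · rw [hd] at hd0
          simpa [hb.ne'] using hd0
      -- The sine in y vanishes on both walls, as the curl identity requires.
      have hC := hu.integral_curl_defect hcurl hω
        (η := fun p => Real.cos (c * p.1 + θ) * Real.sin (d * p.2 + 0))
        (((hccos c θ).comp contDiff_fst).mul ((hcsin d 0).comp contDiff_snd))
        (fun x y => by simp only [hc, hcosper]) (fun x => by simp)
        (fun x => by rw [hd, hsinL, mul_zero])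
      -- The test function is the x-derivative of the mode. In d·(curl identity) - (divergence
      -- identity) the V0 terms cancel and V1 gets the factor c² + d².
      have hD := hdiv (s := fun x => -c * Real.sin (c * x + θ))
        (s' := fun x => -c * (c * Real.cos (c * x + θ)))
        (F := fun y => Real.cos (d * y + 0)) (F' := fun y => -d * Real.sin (d * y + 0))
        (fun x => (hdsin c θ x).const_mul (-c)) (hdcos d 0)
        (contDiff_const.mul (hcsin c θ)) (contDiff_const.mul (contDiff_const.mul (hccos c θ)))
        (hccos d 0) (contDiff_const.mul (hcsin d 0))
        (fun x => by simp only [hc, hsinper]) (fun x => by simp only [hc, hcosper])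
      have hsum : d * ∫ p, (V1 p * (Real.cos (c * p.1 + θ) * (d * Real.cos (d * p.2 + 0))) +
          V0 p * (-c * Real.sin (c * p.1 + θ) * Real.sin (d * p.2 + 0))) ∂(vol a b) -
          ∫ p, (V1 p * (-c * (c * Real.cos (c * p.1 + θ)) * Real.cos (d * p.2 + 0)) -
            V0 p * (-c * Real.sin (c * p.1 + θ) * (-d * Real.sin (d * p.2 + 0)))) ∂(vol a b)
          = 0 := by
        have hC' : ∫ p, (V1 p * (Real.cos (c * p.1 + θ) * (d * Real.cos (d * p.2 + 0))) +
          V0 p * (-c * Real.sin (c * p.1 + θ) * Real.sin (d * p.2 + 0))) ∂(vol a b) = 0 := by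
          refine Eq.trans (integral_congr_ae (.of_forall fun p => ?_)) hC
          simp only
          rw [grad_separated_zero (hdcos c θ) (hccos c θ) (hcsin d 0),
            grad_separated_one (hdsin d 0) (hccos c θ) (hcsin d 0)]
        rw [hC', hD, mul_zero, sub_zero]
      rw [← integral_const_mul, ← integral_sub] at hsum
      · have : ∫ p, (c ^ 2 + d ^ 2) * (V1 p * mode a b k θ m p) ∂(vol a b) = 0 := by
          refine Eq.trans (integral_congr_ae (.of_forall fun p => ?_)) hsum
          simp only [mode, add_zero, ← hc, ← hd]
          ring
        rw [integral_const_mul] at this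
        exact (mul_eq_zero.1 this).resolve_left hcd
      · refine Integrable.const_mul (Integrable.add ?_ ?_) d
        · exact integrable_mul_of_memLp hV1 (memLp_vol_of_continuous (by fun_prop) 2)
        · exact integrable_mul_of_memLp hV0 (memLp_vol_of_continuous (by fun_prop) 2)
      · refine Integrable.sub ?_ ?_
        · exact integrable_mul_of_memLp hV1 (memLp_vol_of_continuous (by fun_prop) 2)
        · exact integrable_mul_of_memLp hV0 (memLp_vol_of_continuous (by fun_prop) 2)
  have hV1zero := ae_eq_zero_of_integral_mode_eq_zero ha hb (hV1.integrable one_le_two) hmode1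
  refine ⟨hV1zero, ae_eq_zero_of_integral_mode_eq_zero ha hb (hV0.integrable one_le_two) ?_⟩
  intro k θ m
  -- With V1 = 0, the divergence identity for cos(2akx + θ) F(y) is the mode coefficient of V0 up to
  -- sign. For m = 0 the primitive F(y) = y is allowed, since F needs no condition in y.
  obtain ⟨F, hF, hFc⟩ : ∃ F : ℝ → ℝ, (∀ y, HasDerivAt F (Real.cos (b * m * y)) y) ∧
      ContDiff ℝ (⊤ : ℕ∞) F := by
    by_cases hm : b * m = 0
    · exact ⟨id, fun y => by simpa [hm] using hasDerivAt_id y, contDiff_id⟩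
    · refine ⟨fun y => (b * m)⁻¹ * Real.sin (b * m * y + 0), fun y => ?_,
        contDiff_const.mul (hcsin _ _)⟩
      have := (hdsin (b * m) 0 y).const_mul (b * m : ℝ)⁻¹
      rwa [inv_mul_cancel_left₀ hm, add_zero] at this
  have hD := hdiv (hdcos (2 * a * k) θ) hF (hccos _ _) (contDiff_const.mul (hcsin _ _)) hFc
    (by fun_prop) (hcosper k θ) (fun x => by simp only [hsinper])
  rw [← neg_eq_zero, ← integral_neg, ← hD]
  refine integral_congr_ae ?_
  filter_upwards [hV1zero] with p hp
  rw [hp]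
  simp [mode]

lemma IsVelocity.quotients_eq_of_mem_eigenspace (ha : 0 < a) (hb : 0 < b)
    {u : ℝ × ℝ → EuclideanSpace ℝ (Fin 2)} {ω : ℝ × ℝ → ℝ} {μ : ℝ} (hu : IsVelocity a b u)
    (hcurl : ω =ᵐ[vol a b] curl a b u) (hne : ¬ ω =ᵐ[vol a b] 0)
    (hω : ω ∈ eigenspace a b μ) :
    dissipationQuotient a b ω = rayleighQuotient a b u ω := by
  have hE := enstrophy_pos hω.1.1.isWeakGrad.memLp hne
  have hK := hu.kineticEnergy_pos hcurl hω.1 hne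
  have hle := hu.sq_enstrophy_le hcurl hω.1 hne
  have hg := hω.1.1.isWeakGrad
  -- The eigenvalue equation tested with ω itself, by density.
  have hPE : palinstrophy a b ω = μ * enstrophy a b ω := by
    have h := hω.1.integral_eq_zero (h := fun p => -μ * ω p) (k := weakGrad a b ω)
      (hg.memLp.const_mul _) hg.memLp_grad ?_
    · have hsplit := integral_add ((hg.memLp.integrable_sq).const_mul (-μ))
        (integrable_norm_sq hg.memLp_grad)
      rw [integral_const_mul] at hsplit
      have h' : ∫ p, (-μ * ω p ^ 2 + ‖weakGrad a b ω p‖ ^ 2) ∂(vol a b) = 0 := by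
        refine Eq.trans (integral_congr_ae (.of_forall fun p => ?_)) h
        simp only [real_inner_self_eq_norm_sq]
        ring
      rw [h'] at hsplit
      rw [palinstrophy, enstrophy]
      linarith
    · intro φ hφ
      have he := hω.2 φ hφ
      rw [← sub_eq_zero, ← integral_const_mul, ← integral_sub
        (integrable_inner_of_memLp hg.memLp_grad hφ.memLp_grad)
        ((integrable_mul_of_memLp hg.memLp hφ.memLp).const_mul μ)] at he
      refine Eq.trans (integral_congr_ae (.of_forall fun p => ?_)) he
      simp only
      ring
  obtain ⟨h1, h0⟩ := hu.rotated_grad_ae_eq ha hb hcurl hω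
  have hd := hu.integral_defect hcurl hω.1 μ
  have hzero : ∫ p, ((weakGrad a b ω p 1 - μ * u p 0) ^ 2 +
      (weakGrad a b ω p 0 + μ * u p 1) ^ 2) ∂(vol a b) = 0 := by
    refine integral_eq_zero_of_ae ?_
    filter_upwards [h0, h1] with p hp0 hp1
    rw [hp0, hp1]
    simp
  rw [hzero, hPE] at hd
  -- For μ = 0 one would have P = 0, and E² ≤ KP would contradict E > 0.
  have hμ : μ ≠ 0 := by
    rintro rfl
    rw [hPE] at hle
    nlinarith
  have hEK : enstrophy a b ω = μ * kineticEnergy a b u := by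
    apply mul_left_cancel₀ hμ
    linarith
  rw [dissipationQuotient, rayleighQuotient, hPE, mul_div_cancel_right₀ _ hE.ne', hEK,
    mul_div_cancel_right₀ _ hK.ne']

end KelvinHelmholtz

theorem lemma2 (a b : ℝ) (ha : 0 < a) (hb : 0 < b)
    (u : ℝ × ℝ → EuclideanSpace ℝ (Fin 2)) (ω : ℝ × ℝ → ℝ)
    (hu : IsVelocity a b u) (hcurl : ω =ᵐ[vol a b] curl a b u)
    (hω : MemH10 a b ω) (hne : ¬ ω =ᵐ[vol a b] 0) :
    0 < kineticEnergy a b u ∧ 0 < enstrophy a b ω ∧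
    enstrophy a b ω ^ 2 ≤ kineticEnergy a b u * palinstrophy a b ω ∧
    rayleighQuotient a b u ω ≤ dissipationQuotient a b ω ∧
    (dissipationQuotient a b ω = rayleighQuotient a b u ω ↔
      ∃ μ : ℝ, IsEigenvalue a b μ ∧ ω ∈ eigenspace a b μ) := by
  have hK := hu.kineticEnergy_pos hcurl hω hne
  have hE := enstrophy_pos hω.1.isWeakGrad.memLp hne
  have hle := hu.sq_enstrophy_le hcurl hω hne
  refine ⟨hK, hE, hle, ?_, fun heq => ?_, ?_⟩
  · rw [rayleighQuotient, dissipationQuotient, div_le_div_iff₀ hK hE]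
    linarith
  · have hmem := hu.mem_eigenspace_of_quotients_eq hcurl hω hne heq
    exact ⟨_, ⟨ω, hmem, hne⟩, hmem⟩
  · rintro ⟨μ, -, hmem⟩
    exact hu.quotients_eq_of_mem_eigenspace ha hb hcurl hne hmem
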